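/- **Theorem 3.11 (Adiabatic connection for $F_{\mathrm{LL}}$).** Let $N,M\in\mathbb N_0$, $\Lambda\in\mathbb R^{M\times N}$, $t\in\mathbb R^N$, and let $\mathcal H=L^2(\mathbb R^M,\mathbb C^{2^N})$ with spin components $\psi^\alpha$, $\alpha\in\{+,-\}^N$. Let $\sigma_x^n,\sigma_z^n$ be the Pauli matrices acting on the $n$-th factor of $\mathbb C^{2^N}=\bigotimes^N\mathbb C^2$, and write $\boldsymbol\sigma_z=(\sigma_z^1,\dots,\sigma_z^N)$, $\boldsymbol\sigma_x=(\sigma_x^1,\dots,\sigma_x^N)$. Let $Q_0=\{\psi\in H^1(\mathbb R^M,\mathbb C^{2^N}): |x|\psi\in L^2\}$ be the form domain of $H_0^\Lambda=-\Delta+|x|^2+x\cdot\Lambda\boldsymbol\sigma_z-t\cdot\boldsymbol\sigma_x$, whose quadratic form is $$\langle\psi,H_0^\Lambda\psi\rangle=\|\nabla\psi\|^2+\|x\psi\|^2+\langle\psi,x\cdot\Lambda\boldsymbol\sigma_z\psi\rangle-\langle\psi,t\cdot\boldsymbol\sigma_x\psi\rangle .$$ For $\sigma\in[-1,1]^N$,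 $\xi\in\mathbb R^M$ put $$\mathcal M_{\sigma,\xi}=\{\psi\in Q_0:\|\psi\|=1,\ \langle\psi,\boldsymbol\sigma_z\psi\rangle=\sigma,\ \langle\psi,x\psi\rangle=\xi\},\qquad F_{\mathrm{LL}}^\Lambda(\sigma,\xi)=\inf_{\psi\in\mathcal M_{\sigma,\xi}}\langle\psi,H_0^\Lambda\psi\rangle ;$$ an optimizer of $F_{\mathrm{LL}}^\Lambda(\sigma,\xi)$ is a $\psi\in\mathcal M_{\sigma,\xi}$ attaining this infimum. Then, for every $\sigma\in[-1,1]^N$, the infimum $F_{\mathrm{LL}}^\Lambda(\sigma,\xi)$ is a real number for every $\xi$; for every $s\in[0,1]$ there is a real-valued optimizer of $F_{\mathrm{LL}}^{s\Lambda}(\sigma,0)$; and for every choice of real-valued optimizers $\psi_{s\Lambda}\in\mathcal M_{\sigma,0}$ of $F_{\mathrm{LL}}^{s\Lambda}(\sigma,0)$, $s\in[0,1]$, the integrand below is integrable on $[0,1]$ and, for all $\xi\in\mathbb R^M$, $$F_{\mathrm{LL}}^\Lambda(\sigma,\xi)=M+|\xi|^2-\sum_{n=1}^N|t_n|\sqrt{1-\sigma_n^2}+\xi\cdot\Lambda\sigma+G^\Lambda(\sigma),$$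 $$G^\Lambda(\sigma)=\tfrac14|\Lambda\sigma|^2-\int_0^1\Big(\tfrac s2\,\|\Lambda\boldsymbol\sigma_z\psi_{s\Lambda}\|^2+\big\langle t\cdot\boldsymbol\sigma_x\psi_{s\Lambda},\ \nabla\cdot\Lambda(\boldsymbol\sigma_z-\sigma)\psi_{s\Lambda}\big\rangle\Big)\,ds ,$$ where $\nabla\cdot\Lambda(\boldsymbol\sigma_z-\sigma)\psi=\sum_{m,n}\Lambda_{mn}(\sigma_z^n-\sigma_n)\,\partial_{x_m}\psi$. (If all $t_n\ge0$, then $|t_n|=t_n$.) -/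

import Mathlib

open MeasureTheory Matrix

namespace Dicke

noncomputable section

/-- The configuration space of the `M` field modes. -/
abbrev Pos (M : ℕ) : Type := EuclideanSpace ℝ (Fin M)

/-- The scalar space `L²(ℝ^M)` of complex-valued square-integrable functions. -/
abbrev L2 (M : ℕ) : Type := Lp ℂ 2 (volume : Measure (Pos M))

/-- Spin multi-indices: the letter `+` is `0`, the letter `-` is `1`. -/
abbrev Spin (N : ℕ) : Type := Fin N → Fin 2

/-- The state space `L²(ℝ^M, ℂ^{2^N})`, with inner product
`⟨φ, ψ⟩ = ∑_α ∫ conj (φ^α) ψ^α`, conjugate-linear in the first argument. -/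
abbrev State (N M : ℕ) : Type := PiLp 2 (fun _ : Spin N => L2 M)

/-! ### Pauli matrices and their lifts -/

def pauliX : Matrix (Fin 2) (Fin 2) ℂ := !![0, 1; 1, 0]

def pauliZ : Matrix (Fin 2) (Fin 2) ℂ := !![1, 0; 0, -1]

/-- `1 ⊗ ⋯ ⊗ 1 ⊗ A ⊗ 1 ⊗ ⋯ ⊗ 1` with `A` in the `n`-th place, in entries. -/
def lift {N : ℕ} (n : Fin N) (A : Matrix (Fin 2) (Fin 2) ℂ) : Matrix (Spin N) (Spin N) ℂ :=
  Matrix.of fun α β => ∏ k, (if k = n then A else 1) (α k) (β k)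

/-- The action of a `2^N × 2^N` matrix on the spin components of a state. -/
def act {N M : ℕ} (A : Matrix (Spin N) (Spin N) ℂ) (ψ : State N M) : State N M :=
  WithLp.toLp 2 fun α => ∑ β, A α β • ψ β

def sigmaX {N M : ℕ} (n : Fin N) (ψ : State N M) : State N M := act (lift n pauliX) ψ

def sigmaZ {N M : ℕ} (n : Fin N) (ψ : State N M) : State N M := act (lift n pauliZ) ψ

/-! ### Weak derivatives, position operators, form domain -/

/-- `g` is the weak partial derivative `∂f/∂x_m`. -/
def HasWeakPartial {M : ℕ} (m : Fin M) (f g : L2 M) : Prop :=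
  ∀ η : Pos M → ℝ, ContDiff ℝ (⊤ : ℕ∞) η → HasCompactSupport η →
    ∫ x, ((fderiv ℝ η x (EuclideanSpace.single m 1) : ℝ) : ℂ) * f x
      = - ∫ x, ((η x : ℝ) : ℂ) * g x

/-- Weak partial derivatives are unique. -/
theorem HasWeakPartial.unique {M : ℕ} {m : Fin M} {f g h : L2 M}
    (hg : HasWeakPartial m f g) (hh : HasWeakPartial m f h) : g = h := by
  have hgl : LocallyIntegrable (g : Pos M → ℂ) volume :=
    (Lp.memLp g).locallyIntegrable (by norm_num)
  have hhl : LocallyIntegrable (h : Pos M → ℂ) volume :=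
    (Lp.memLp h).locallyIntegrable (by norm_num)
  apply Lp.ext
  refine ae_eq_of_integral_contDiff_smul_eq hgl hhl ?_
  intro η hη hc
  have h1 := hg η hη hc
  have h2 := hh η hη hc
  have h3 := neg_injective (h1.symm.trans h2)
  simpa only [Complex.real_smul] using h3

open Classical in
/-- The weak partial derivative as an operator on `L²(ℝ^M)`; its value is used only where the
weak derivative exists in `L²`. -/
def weakPartial {M : ℕ} (m : Fin M) (f : L2 M) : L2 M :=
  if h : ∃ g, HasWeakPartial m f g then h.choose else 0

/-- `f` is in the domain of multiplication by `x_m`, that is, `x_m f ∈ L²`. -/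
def MulMem {M : ℕ} (m : Fin M) (f : L2 M) : Prop :=
  MemLp (fun x : Pos M => ((x m : ℝ) : ℂ) * f x) 2 volume

open Classical in
/-- Multiplication by `x_m`; its value is used only on the domain of this operator. -/
def mulCoord {M : ℕ} (m : Fin M) (f : L2 M) : L2 M :=
  if h : MulMem m f then h.toLp _ else 0

/-- `∂_{x_m}` acting on states, componentwise. -/
def partialState {N M : ℕ} (m : Fin M) (ψ : State N M) : State N M :=
  WithLp.toLp 2 fun α => weakPartial m (ψ α)

/-- Multiplication of a state by `x_m`. -/
def posState {N M : ℕ} (m : Fin M) (ψ : State N M) : State N M :=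
  WithLp.toLp 2 fun α => mulCoord m (ψ α)

/-- The form domain `Q₀` of the Hamiltonian: `ψ ∈ H¹` and `|x| ψ ∈ L²`. It depends neither on the
coupling matrix nor on `t`, which enter as form-bounded perturbations. -/
def formDomain (N M : ℕ) : Set (State N M) :=
  {ψ | ∀ (α : Spin N) (m : Fin M), (∃ g, HasWeakPartial m (ψ α) g) ∧ MulMem m (ψ α)}

/-! ### Energy, constraints and the Levy-Lieb functional -/

/-- The operator `t · σ_x`. -/
def tSigmaX {N M : ℕ} (t : Fin N → ℝ) (ψ : State N M) : State N M :=
  ∑ n, (t n : ℂ) • sigmaX n ψ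

/-- The `m`-th entry of the `M`-vector of operators `Λ σ_z`. -/
def couplingZ {N M : ℕ} (Λ : Matrix (Fin M) (Fin N) ℝ) (m : Fin M) (ψ : State N M) : State N M :=
  ∑ n, (Λ m n : ℂ) • sigmaZ n ψ

/-- The quadratic form `⟨ψ, H₀ ψ⟩` on `Q₀` of
`H₀ = -Δ + |x|² + x · Λ σ_z - t · σ_x`, namely
`‖∇ψ‖² + ‖xψ‖² + ⟨ψ, x · Λ σ_z ψ⟩ - ⟨ψ, t · σ_x ψ⟩`. The last two terms are real. -/
def energy {N M : ℕ} (Λ : Matrix (Fin M) (Fin N) ℝ) (t : Fin N → ℝ) (ψ : State N M) : ℝ :=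
  (∑ m, ‖partialState m ψ‖ ^ 2) + (∑ m, ‖posState m ψ‖ ^ 2)
    + (∑ m, (inner ℂ ψ (posState m (couplingZ Λ m ψ))).re)
    - (inner ℂ ψ (tSigmaX t ψ)).re

/-- The magnetization vector `⟨ψ, σ_z ψ⟩`. -/
def magnetization {N M : ℕ} (ψ : State N M) (n : Fin N) : ℝ := (inner ℂ ψ (sigmaZ n ψ)).re

/-- The displacement vector `⟨ψ, x ψ⟩`. -/
def displacement {N M : ℕ} (ψ : State N M) (m : Fin M) : ℝ := (inner ℂ ψ (posState m ψ)).re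

/-- The constraint set `𝓜_{σ,ξ}`. -/
def constraintSet {N M : ℕ} (σ : Fin N → ℝ) (ξ : Fin M → ℝ) : Set (State N M) :=
  {ψ | ψ ∈ formDomain N M ∧ ‖ψ‖ = 1 ∧ magnetization ψ = σ ∧ displacement ψ = ξ}

/-- The Levy-Lieb functional `F_LL^Λ(σ, ξ)`. -/
def levyLieb {N M : ℕ} (Λ : Matrix (Fin M) (Fin N) ℝ) (t : Fin N → ℝ)
    (σ : Fin N → ℝ) (ξ : Fin M → ℝ) : ℝ :=
  sInf (energy Λ t '' constraintSet σ ξ)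

/-- `ψ` is an optimizer of `F_LL^Λ(σ, ξ)`: it attains the infimum over the constraint set. -/
def IsOptimizer {N M : ℕ} (Λ : Matrix (Fin M) (Fin N) ℝ) (t : Fin N → ℝ)
    (σ : Fin N → ℝ) (ξ : Fin M → ℝ) (ψ : State N M) : Prop :=
  ψ ∈ constraintSet σ ξ ∧ IsMinOn (energy Λ t) (constraintSet σ ξ) ψ

/-- All spin components are real-valued (almost everywhere). -/
def IsRealValued {N M : ℕ} (ψ : State N M) : Prop :=
  ∀ α, ∀ᵐ x ∂(volume : Measure (Pos M)), (ψ α x).im = 0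

/-! ### The integrand of the adiabatic connection -/

/-- `‖Λ σ_z ψ‖²`, the squared norm of an `M`-vector of states. -/
def couplingNormSq {N M : ℕ} (Λ : Matrix (Fin M) (Fin N) ℝ) (ψ : State N M) : ℝ :=
  ∑ m, ‖couplingZ Λ m ψ‖ ^ 2

/-- `∇ · Λ (σ_z - σ) ψ = ∑_{m,n} Λ_{mn} (σ_z^n - σ_n) ∂_{x_m} ψ`. -/
def divCoupling {N M : ℕ} (Λ : Matrix (Fin M) (Fin N) ℝ) (σ : Fin N → ℝ) (ψ : State N M) :
    State N M :=
  ∑ m, ∑ n, (Λ m n : ℂ) • (sigmaZ n (partialState m ψ) - (σ n : ℂ) • partialState m ψ)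

/-- The integrand
`(s / 2) ‖Λ σ_z ψ‖² + ⟨t · σ_x ψ, ∇ · Λ (σ_z - σ) ψ⟩` at coupling strength `s`.
For real-valued `ψ` the inner product is real. -/
def adiabaticIntegrand {N M : ℕ} (Λ : Matrix (Fin M) (Fin N) ℝ) (t σ : Fin N → ℝ)
    (s : ℝ) (ψ : State N M) : ℝ :=
  s / 2 * couplingNormSq Λ ψ + (inner ℂ (tSigmaX t ψ) (divCoupling Λ σ ψ)).re

end

end Dicke

/-! Fix `σ`. A common translation of all spin components shifts `ξ` and changes the energy by an
amount that does not depend on the state, so `ξ = 0` suffices (`IsOptimizer.levyLieb_displaced`).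

At `ξ = 0` put `F(s) = F_LL^{sΛ}(σ, 0)`. For each state the energy is affine in `s` with slope the
interaction energy `I(ψ) = ⟨ψ, x · Λσ_z ψ⟩` (`energy_smul`). Hence `F` is an infimum of affine
functions, concave, and `I(ψ_s)` is a supergradient at `s` for every choice of optimizers. So `s ↦
I(ψ_s)` is antitone, therefore integrable, and integrates to `F(1) - F(0)`; no measurable choice of
optimizers is involved (`integral_eq_sub_of_supergradient`). The value `F(0)` is the oscillator
ground state energy plus optimal one-spin energies (`le_energy_zero`, `exists_energy_zero_eq`).

It remains to rewrite the slope. Translating the component `ψ^α` by `ε w_α`, where `w_α` is the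
eigenvalue of `Λσ_z` at `α` minus `Λσ`, preserves every constraint, because the mean of `w_α` with
weights `‖ψ^α‖²` is zero. Stationarity at `ε = 0` is a virial identity: `I(ψ_s) = (s/2)|Λσ|²` minus
the adiabatic integrand (`IsOptimizer.interaction_eq`). The kinetic energy is translation invariant,
so one weak derivative of `ψ` is enough. Integrating `s/2` over `[0, 1]` gives the factor `1/4`.

Optimizers exist by the direct method (`exists_isOptimizer`): the harmonic trap makes the form
domain compact in `L²`, so the constraints survive weak limits. A real-valued optimizer comes from
the diamagnetic inequality, with signs adapted to `t` (`IsOptimizer.exists_isRealValued`). -/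

namespace Dicke

open Filter Topology

noncomputable section

/-! ### Scalar analysis: translations and weak derivatives. -/

section Scalar

variable {M : ℕ}

/-! ### Translations and test functions in `L²(ℝ^M)` -/

/-- The translation `f ↦ f (· + v)` as an isometry of `L²`. -/
def translate (v : Pos M) : L2 M →ₗᵢ[ℂ] L2 M :=
  Lp.compMeasurePreservingₗᵢ ℂ (fun x => x + v) (measurePreserving_add_right volume v)

theorem translate_coeFn (v : Pos M) (f : L2 M) :
    translate v f =ᵐ[volume] fun x => f (x + v) :=
  Lp.coeFn_compMeasurePreserving f (measurePreserving_add_right volume v)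

theorem continuous_translate {f : L2 M} : Continuous fun v => translate v f := by
  have h : Continuous fun v : Pos M => (⟨fun x => x + v, by fun_prop⟩ : C(Pos M, Pos M)) :=
    ContinuousMap.continuous_of_continuous_uncurry _ (by
      change Continuous fun p : Pos M × Pos M => p.2 + p.1
      fun_prop)
  exact Continuous.compMeasurePreservingLp (f := fun _ => f) continuous_const h
    (fun v => measurePreserving_add_right volume v) (by norm_num)

/-- Precomposition with a translation respects almost everywhere equality. -/
theorem ae_eq_comp_add {E : Type*} {f g : Pos M → E} (h : f =ᵐ[volume] g) (v : Pos M) :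
    (fun x => f (x + v)) =ᵐ[volume] fun x => g (x + v) :=
  (measurePreserving_add_right volume v).quasiMeasurePreserving.ae_eq_comp h

theorem translate_translate (v w : Pos M) (f : L2 M) :
    translate v (translate w f) = translate (v + w) f := by
  apply Lp.ext
  filter_upwards [translate_coeFn v (translate w f), ae_eq_comp_add (translate_coeFn w f) v,
    translate_coeFn (v + w) f] with x h1 h2 h3
  rw [h1, h2, h3, add_assoc]

theorem translate_zero (f : L2 M) : translate 0 f = f := by
  apply Lp.ext
  filter_upwards [translate_coeFn 0 f] with x h1
  rw [h1, add_zero]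

theorem inner_translate (v : Pos M) (f g : L2 M) :
    inner ℂ (translate v f) g = inner ℂ f (translate (-v) g) := by
  rw [← (translate v).inner_map_map f, translate_translate, add_neg_cancel, translate_zero]

/-- Smooth functions with compact support. -/
def IsTest (η : Pos M → ℝ) : Prop := ContDiff ℝ (⊤ : ℕ∞) η ∧ HasCompactSupport η

theorem IsTest.memLp {η : Pos M → ℝ} (h : IsTest η) :
    MemLp (fun x => ((η x : ℝ) : ℂ)) 2 (volume : Measure (Pos M)) := by
  have : MemLp η 2 (volume : Measure (Pos M)) := h.1.continuous.memLp_of_hasCompactSupport h.2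
  exact this.ofReal

/-- A test function as an element of `L²`. -/
def IsTest.toL2 {η : Pos M → ℝ} (h : IsTest η) : L2 M := h.memLp.toLp _

theorem IsTest.inner_toL2 {η : Pos M → ℝ} (h : IsTest η) (f : L2 M) :
    inner ℂ h.toL2 f = ∫ x, ((η x : ℝ) : ℂ) * f x := by
  rw [L2.inner_def]
  apply integral_congr_ae
  filter_upwards [h.memLp.coeFn_toLp] with x hx
  simp only [IsTest.toL2, hx, RCLike.inner_apply, Complex.conj_ofReal]
  ring

theorem IsTest.fderiv_apply {η : Pos M → ℝ} (h : IsTest η) (v : Pos M) :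
    IsTest fun x => fderiv ℝ η x v :=
  ⟨(h.1.fderiv_right (m := (⊤ : ℕ∞)) (by simp)).clm_apply contDiff_const,
    h.2.fderiv_apply (𝕜 := ℝ) v⟩

theorem IsTest.comp_add {η : Pos M → ℝ} (h : IsTest η) (v : Pos M) :
    IsTest fun x => η (x + v) :=
  ⟨h.1.comp (contDiff_id.add contDiff_const), h.2.comp_homeomorph (Homeomorph.addRight v)⟩

/-- Test functions are total in `L²`. -/
theorem eq_of_inner_test {f g : L2 M}
    (h : ∀ η (hη : IsTest η), inner ℂ hη.toL2 f = inner ℂ hη.toL2 g) : f = g := by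
  apply Lp.ext
  refine ae_eq_of_integral_contDiff_smul_eq ((Lp.memLp f).locallyIntegrable (by norm_num))
    ((Lp.memLp g).locallyIntegrable (by norm_num)) fun η h1 h2 => ?_
  have := h η ⟨h1, h2⟩
  rw [IsTest.inner_toL2 ⟨h1, h2⟩, IsTest.inner_toL2 ⟨h1, h2⟩] at this
  simpa only [Complex.real_smul] using this

/-! ### Directional weak derivatives -/

/-- `g` is the weak derivative of `f` in direction `v`. -/
def HasWeakDirDeriv (v : Pos M) (f g : L2 M) : Prop :=
  ∀ η : Pos M → ℝ, IsTest η →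
    ∫ x, ((fderiv ℝ η x v : ℝ) : ℂ) * f x = - ∫ x, ((η x : ℝ) : ℂ) * g x

theorem hasWeakPartial_iff {m : Fin M} {f g : L2 M} :
    HasWeakPartial m f g ↔ HasWeakDirDeriv (EuclideanSpace.single m 1) f g :=
  ⟨fun h η hη => h η hη.1 hη.2, fun h η h1 h2 => h η ⟨h1, h2⟩⟩

theorem hasWeakDirDeriv_iff {v : Pos M} {f g : L2 M} :
    HasWeakDirDeriv v f g ↔ ∀ η (hη : IsTest η),
      inner ℂ (hη.fderiv_apply v).toL2 f = - inner ℂ hη.toL2 g := by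
  simp only [IsTest.inner_toL2, HasWeakDirDeriv]

theorem HasWeakDirDeriv.translate {v : Pos M} {f g : L2 M} (h : HasWeakDirDeriv v f g)
    (w : Pos M) : HasWeakDirDeriv v (translate w f) (translate w g) := by
  have key : ∀ (θ : Pos M → ℝ) (u : L2 M), ∫ x, ((θ x : ℝ) : ℂ) * Dicke.translate w u x
      = ∫ x, ((θ (x + -w) : ℝ) : ℂ) * u x := by
    intro θ u
    rw [← integral_add_right_eq_self (fun x => ((θ (x + -w) : ℝ) : ℂ) * u x) w]
    apply integral_congr_ae
    filter_upwards [translate_coeFn w u] with x hx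
    rw [hx, add_neg_cancel_right]
  intro η hη
  rw [key, key, ← h _ (hη.comp_add (-w))]
  simp only [fderiv_comp_add_right]

/-- Linearity of `fderiv` in the direction, applied to the test function. Arbitrary directions are
needed because spin components will be moved along arbitrary vectors. -/
theorem HasWeakPartial.weakDirDeriv_sum {f : L2 M} {g : Fin M → L2 M}
    (h : ∀ m, HasWeakPartial m f (g m)) (v : Pos M) :
    HasWeakDirDeriv v f (∑ m, ((v m : ℝ) : ℂ) • g m) := by
  rw [hasWeakDirDeriv_iff]
  intro η hη
  have e : (hη.fderiv_apply v).toL2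
      = ∑ m, ((v m : ℝ) : ℂ) • (hη.fderiv_apply (EuclideanSpace.single m 1)).toL2 := by
    apply Lp.ext
    have h2 : ∀ m, (((v m : ℝ) : ℂ) • (hη.fderiv_apply (EuclideanSpace.single m 1)).toL2 : L2 M)
        =ᵐ[volume] fun x => ((v m * fderiv ℝ η x (EuclideanSpace.single m 1) : ℝ) : ℂ) := by
      intro m
      filter_upwards [(hη.fderiv_apply (EuclideanSpace.single m 1)).memLp.coeFn_toLp,
        Lp.coeFn_smul ((v m : ℝ) : ℂ) (hη.fderiv_apply (EuclideanSpace.single m 1)).toL2]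
        with x h1 h2
      rw [h2, Pi.smul_apply, IsTest.toL2, h1]
      simp
    filter_upwards [(hη.fderiv_apply v).memLp.coeFn_toLp, ae_all_iff.2 h2,
      Lp.coeFn_finsetSum Finset.univ fun m =>
        (((v m : ℝ) : ℂ) • (hη.fderiv_apply (EuclideanSpace.single m 1)).toL2 : L2 M)]
        with x h1 h2 h3
    rw [h3, IsTest.toL2, h1, Finset.sum_apply, Finset.sum_congr rfl fun m _ => h2 m,
      ← Complex.ofReal_sum]
    congr 1
    have hv : v = ∑ m, v m • EuclideanSpace.single m (1 : ℝ) := by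
      ext i; simp [Finset.sum_apply, Pi.single_apply]
    conv_lhs => rw [hv]
    rw [map_sum]
    simp
  rw [e, sum_inner, inner_sum, ← Finset.sum_neg_distrib]
  refine Finset.sum_congr rfl fun m _ => ?_
  rw [inner_smul_left, inner_smul_right, Complex.conj_ofReal,
    hasWeakDirDeriv_iff.1 (hasWeakPartial_iff.1 (h m)) η hη, mul_neg]

/-- The pairing is the convolution of `f` with the reflection of `η`, evaluated at `s • v`. The
derivative falls on `η`, so `f` need not be differentiable in any sense. -/
theorem hasDerivAt_inner_test_translate_zero {η : Pos M → ℝ} (hη : IsTest η) (v : Pos M)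
    (f : L2 M) :
    HasDerivAt (fun s : ℝ => inner ℂ hη.toL2 (translate (s • v) f))
      (-inner ℂ (hη.fderiv_apply v).toL2 f) 0 := by
  have hη' : IsTest fun x => η (-x) :=
    ⟨hη.1.comp contDiff_neg, hη.2.comp_homeomorph (Homeomorph.neg _)⟩
  set L : ℂ →L[ℝ] ℝ →L[ℝ] ℂ := (ContinuousLinearMap.lsmul ℝ ℝ).flip with hL
  have hf : LocallyIntegrable (f : Pos M → ℂ) volume :=
    (Lp.memLp f).locallyIntegrable (by norm_num)
  have h1 := hη'.2.hasFDerivAt_convolution_right L hf (hη'.1.of_le (by simp)) ((0 : ℝ) • v)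
  have h2 : HasDerivAt (fun s : ℝ => s • v) v 0 := by
    simpa using (hasDerivAt_id (0 : ℝ)).smul_const v
  have h3 := h1.comp_hasDerivAt (0 : ℝ) h2
  rw [convolution_precompR_apply L hf (hη'.2.fderiv ℝ)
    (hη'.1.continuous_fderiv (by simp))] at h3
  have e1 : (fun s : ℝ => inner ℂ hη.toL2 (translate (s • v) f))
      = convolution (⇑f) (fun x => η (-x)) L volume ∘ fun s => s • v := by
    ext s
    rw [hη.inner_toL2, Function.comp_apply, convolution_def,
      ← integral_add_right_eq_self (fun x => L (f x) (η (-(s • v - x)))) (s • v)]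
    apply integral_congr_ae
    filter_upwards [translate_coeFn (s • v) f] with x hx
    simp [hx, hL]
  have e2 : -inner ℂ (hη.fderiv_apply v).toL2 f = convolution (⇑f)
      (fun a => (fderiv ℝ (fun x => η (-x)) a) v) L volume ((0 : ℝ) • v) := by
    rw [(hη.fderiv_apply v).inner_toL2, convolution_def, ← integral_neg]
    apply integral_congr_ae
    filter_upwards with x
    have : fderiv ℝ (fun x => η (-x)) (-x) v = - fderiv ℝ η x v := by
      have h4 : HasFDerivAt η (fderiv ℝ η x) (-(-x)) := by
        rw [neg_neg]; exact (hη.1.differentiable (by simp) x).hasFDerivAt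
      have h5 := h4.comp (-x) (hasFDerivAt_id (𝕜 := ℝ) (-x)).neg
      rw [show (fun x => η (-x)) = η ∘ fun x => -x from rfl, HasFDerivAt.fderiv h5]
      simp
    simp [hL, this]
  rw [e1, e2]
  exact h3

theorem HasWeakDirDeriv.hasDerivAt_inner_test {v : Pos M} {f g : L2 M}
    (h : HasWeakDirDeriv v f g) {η : Pos M → ℝ} (hη : IsTest η) (s : ℝ) :
    HasDerivAt (fun s : ℝ => inner ℂ hη.toL2 (Dicke.translate (s • v) f))
      (inner ℂ hη.toL2 (Dicke.translate (s • v) g)) s := by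
  have h1 := hasDerivAt_inner_test_translate_zero hη v (Dicke.translate (s • v) f)
  rw [hasWeakDirDeriv_iff.1 (h.translate (s • v)) η hη, neg_neg, ← sub_self s] at h1
  have h2 := h1.comp_sub_const s s
  simpa [translate_translate, ← add_smul] using h2

/-- The fundamental theorem of calculus along a line for weakly differentiable functions. -/
theorem HasWeakDirDeriv.translate_sub_eq_integral {v : Pos M} {f g : L2 M}
    (h : HasWeakDirDeriv v f g) (s : ℝ) :
    Dicke.translate (s • v) f - f = ∫ r in (0 : ℝ)..s, Dicke.translate (r • v) g := by
  have hc : Continuous fun r : ℝ => Dicke.translate (r • v) g :=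
    continuous_translate.comp (by fun_prop)
  -- After pairing with a test function both sides are scalar, and the ordinary fundamental theorem
  -- applies.
  apply eq_of_inner_test
  intro η hη
  have h1 := (innerSL ℂ hη.toL2).intervalIntegral_comp_comm
    (hc.intervalIntegrable (μ := volume) 0 s)
  simp only [innerSL_apply_apply] at h1
  rw [← h1, intervalIntegral.integral_eq_sub_of_hasDerivAt
    (fun r _ => h.hasDerivAt_inner_test hη r)
    ((continuous_const.inner hc).intervalIntegrable 0 s)]
  simp [translate_zero, inner_sub_right]

theorem HasWeakDirDeriv.norm_translate_sub_le {v : Pos M} {f g : L2 M}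
    (h : HasWeakDirDeriv v f g) : ‖Dicke.translate v f - f‖ ≤ ‖g‖ := by
  have h1 := h.translate_sub_eq_integral 1
  rw [one_smul] at h1
  rw [h1]
  refine (intervalIntegral.norm_integral_le_of_norm_le_const (C := ‖g‖) fun r _ => ?_).trans ?_
  · rw [LinearIsometry.norm_map]
  · simp

/-- The integrand of the preceding formula is norm continuous, which upgrades a weak derivative to a
norm derivative of the translation orbit. -/
theorem HasWeakDirDeriv.hasDerivAt {v : Pos M} {f g : L2 M}
    (h : HasWeakDirDeriv v f g) : HasDerivAt (fun s : ℝ => Dicke.translate (s • v) f) g 0 := by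
  have hc : Continuous fun r : ℝ => Dicke.translate (r • v) g :=
    continuous_translate.comp (by fun_prop)
  have h1 := (hc.integral_hasStrictDerivAt 0 0).hasDerivAt.const_add f
  simp only [zero_smul, translate_zero, ← h.translate_sub_eq_integral, add_sub_cancel] at h1
  exact h1

theorem HasWeakDirDeriv.const_smul {v : Pos M} {f g : L2 M} (h : HasWeakDirDeriv v f g)
    (c : ℝ) : HasWeakDirDeriv (c • v) f ((c : ℂ) • g) := by
  rw [hasWeakDirDeriv_iff] at h ⊢
  intro η hη
  rw [inner_smul_right, ← mul_neg, ← h η hη, ← Complex.conj_ofReal, ← inner_smul_left]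
  congr 1
  apply Lp.ext
  filter_upwards [(hη.fderiv_apply v).memLp.coeFn_toLp, (hη.fderiv_apply (c • v)).memLp.coeFn_toLp,
    Lp.coeFn_smul (c : ℂ) (hη.fderiv_apply v).toL2] with x h1 h2 h3
  rw [h3, Pi.smul_apply, IsTest.toL2, IsTest.toL2, h1, h2]
  simp

end Scalar

/-! ### Weak sequential compactness in Hilbert space. -/

section WeakCompactness

/-- Bounded sequences in a separable Hilbert space have weakly convergent subsequences. -/
theorem exists_subseq_weak_tendsto {H : Type*} [NormedAddCommGroup H] [InnerProductSpace ℂ H]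
    [CompleteSpace H] [TopologicalSpace.SeparableSpace H] {u : ℕ → H} {C : ℝ}
    (hu : ∀ n, ‖u n‖ ≤ C) :
    ∃ (l : H) (φ : ℕ → ℕ), StrictMono φ ∧
      ∀ w, Tendsto (fun n => inner ℂ w (u (φ n))) atTop (𝓝 (inner ℂ w l)) := by
  obtain ⟨y, -, φ, hφ, hy⟩ := WeakDual.isSeqCompact_closedBall ℂ H 0 C
    (x := fun n => StrongDual.toWeakDual (InnerProductSpace.toDual ℂ H (u n)))
    (fun n => by
      change InnerProductSpace.toDual ℂ H (u n) ∈ Metric.closedBall 0 C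
      rw [mem_closedBall_zero_iff, LinearIsometryEquiv.norm_map]
      exact hu n)
  refine ⟨(InnerProductSpace.toDual ℂ H).symm (WeakDual.toStrongDual y), φ, hφ, fun w => ?_⟩
  have h1 := ((WeakDual.eval_continuous w).tendsto y).comp hy
  -- The Riesz map places `u n` in the conjugate-linear slot, so the weak-* limit has to be
  -- conjugated.
  have h2 := (Complex.continuous_conj.tendsto _).comp h1
  convert h2 using 2
  · simp only [Function.comp_apply]
    exact (inner_conj_symm _ _).symm
  · rw [← inner_conj_symm, InnerProductSpace.toDual_symm_apply]
    rfl

/-- Testing with `l` itself gives `‖l‖² = lim |⟨l, u n⟩| ≤ ‖l‖ C`. -/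
theorem norm_le_of_weak_tendsto {H : Type*} [NormedAddCommGroup H] [InnerProductSpace ℂ H]
    {u : ℕ → H} {l : H} {C : ℝ} (hu : ∀ n, ‖u n‖ ≤ C)
    (h : Tendsto (fun n => inner ℂ l (u n)) atTop (𝓝 (inner ℂ l l))) : ‖l‖ ≤ C := by
  have hC : 0 ≤ C := (norm_nonneg _).trans (hu 0)
  have h1 : ‖inner ℂ l l‖ ≤ ‖l‖ * C := by
    refine le_of_tendsto h.norm (Eventually.of_forall fun n => ?_)
    exact (norm_inner_le_norm _ _).trans (mul_le_mul_of_nonneg_left (hu n) (norm_nonneg _))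
  rw [inner_self_eq_norm_sq_to_K] at h1
  simp only [Complex.coe_algebraMap, norm_pow, Complex.norm_real, norm_norm] at h1
  by_contra! h2
  have : 0 < ‖l‖ := hC.trans_lt h2
  nlinarith

/-- Serves the instance search for separability of `L²`. -/
instance : Fact ((2 : ENNReal) ≠ ⊤) := ⟨by norm_num⟩

/-- Finitely many bounded sequences in `L²(ℝ^M)` converge weakly along a common subsequence. -/
theorem exists_subseq_weak_tendsto_family {M : ℕ} {ι : Type*} [Fintype ι] {u : ι → ℕ → L2 M}
    {C : ℝ} (hu : ∀ i n, ‖u i n‖ ≤ C) :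
    ∃ (l : ι → L2 M) (φ : ℕ → ℕ), StrictMono φ ∧
      ∀ i w, Tendsto (fun n => inner ℂ w (u i (φ n))) atTop (𝓝 (inner ℂ w (l i))) := by
  classical
  -- The family is treated as one bounded sequence in the Hilbert sum; vectors supported in one slot
  -- then recover the components.
  obtain ⟨l, φ, hφ, hl⟩ := exists_subseq_weak_tendsto (H := PiLp 2 fun _ : ι => L2 M)
    (u := fun n => WithLp.toLp 2 fun i => u i n) (C := √(∑ _i : ι, C ^ 2)) (fun n => by
      rw [PiLp.norm_eq_of_L2]
      exact Real.sqrt_le_sqrt (Finset.sum_le_sum fun i _ =>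
        pow_le_pow_left₀ (norm_nonneg _) (hu i n) 2))
  refine ⟨fun i => l i, φ, hφ, fun i w => ?_⟩
  have key : ∀ x : PiLp 2 fun _ : ι => L2 M,
      inner ℂ (WithLp.toLp 2 (Pi.single i w) : PiLp 2 fun _ : ι => L2 M) x = inner ℂ w (x i) := by
    intro x
    rw [PiLp.inner_apply, Finset.sum_eq_single i]
    · simp
    · intro j _ hj
      simp [Pi.single_eq_of_ne hj]
    · simp
  have := hl (WithLp.toLp 2 (Pi.single i w))
  simp only [key] at this
  exact this

end WeakCompactness

/-! ### Modulus, multiplication by coordinates, commutation relation. -/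

section Scalar

variable {M : ℕ}

/-- An `L²` function that is Lipschitz under translations in a direction has a weak derivative
in that direction. -/
theorem exists_weakDirDeriv_of_norm_translate_sub_le {v : Pos M} {f : L2 M} {C : ℝ}
    (h : ∀ s : ℝ, ‖translate (s • v) f - f‖ ≤ |s| * C) :
    ∃ g, HasWeakDirDeriv v f g ∧ ‖g‖ ≤ C := by
  -- The difference quotients with these steps are bounded by `C`; any weak limit point is the
  -- derivative sought.
  let r : ℕ → ℝ := fun n => 1 / ((n : ℝ) + 1)
  have hr : ∀ n, 0 < r n := fun n => Nat.one_div_pos_of_nat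
  have hr0 : Tendsto r atTop (𝓝[≠] 0) :=
    tendsto_nhdsWithin_iff.2 ⟨tendsto_one_div_add_atTop_nhds_zero_nat,
      Eventually.of_forall fun n => (hr n).ne'⟩
  let u : ℕ → L2 M := fun n => (((r n)⁻¹ : ℝ) : ℂ) • (translate (r n • v) f - f)
  have hu : ∀ n, ‖u n‖ ≤ C := by
    intro n
    have := h (r n)
    rw [abs_of_pos (hr n)] at this
    simp only [u, norm_smul, Complex.norm_real, norm_inv, Real.norm_of_nonneg (hr n).le]
    rwa [inv_mul_le_iff₀ (hr n)]
  obtain ⟨g, φ, hφ, hg⟩ := exists_subseq_weak_tendsto hu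
  refine ⟨g, ?_, norm_le_of_weak_tendsto (fun n => hu (φ n)) (hg g)⟩
  rw [hasWeakDirDeriv_iff]
  intro η hη
  have h1 := (hasDerivAt_iff_tendsto_slope.1 (hasDerivAt_inner_test_translate_zero hη v f)).comp
    (hr0.comp hφ.tendsto_atTop)
  rw [← neg_eq_iff_eq_neg]
  refine tendsto_nhds_unique h1 ?_
  convert hg hη.toL2 using 2 with n
  simp only [Function.comp_apply, slope_def_module, u, inner_smul_right, inner_sub_right,
    zero_smul, translate_zero, sub_zero, Complex.real_smul]

/-! ### The modulus -/

theorem lipschitzWith_ofReal_norm : LipschitzWith 1 fun z : ℂ => ((‖z‖ : ℝ) : ℂ) := by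
  have := Complex.isometry_ofReal.lipschitz.comp (lipschitzWith_one_norm (E := ℂ))
  rwa [one_mul] at this

/-- The pointwise modulus of an `L²` function. -/
def modulus (f : L2 M) : L2 M :=
  lipschitzWith_ofReal_norm.compLp (by simp) f

theorem modulus_coeFn (f : L2 M) : modulus f =ᵐ[volume] fun x => ((‖f x‖ : ℝ) : ℂ) :=
  LipschitzWith.coeFn_compLp _ _ f

theorem norm_modulus_sub_le (f g : L2 M) : ‖modulus f - modulus g‖ ≤ ‖f - g‖ := by
  have := lipschitzWith_ofReal_norm.norm_compLp_sub_le (by simp) f g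
  rwa [NNReal.coe_one, one_mul] at this

theorem norm_eq_of_ae_norm_eq {f g : L2 M} (h : ∀ᵐ x, ‖f x‖ = ‖g x‖) : ‖f‖ = ‖g‖ := by
  rw [Lp.norm_def, Lp.norm_def, eLpNorm_congr_norm_ae h]

theorem norm_modulus (f : L2 M) : ‖modulus f‖ = ‖f‖ := by
  apply norm_eq_of_ae_norm_eq
  filter_upwards [modulus_coeFn f] with x hx
  simp [hx]

theorem translate_modulus (v : Pos M) (f : L2 M) :
    translate v (modulus f) = modulus (translate v f) := by
  apply Lp.ext
  filter_upwards [translate_coeFn v (modulus f), ae_eq_comp_add (modulus_coeFn f) v,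
    modulus_coeFn (translate v f), translate_coeFn v f] with x h1 h2 h3 h4
  rw [h1, h2, h3, h4]

/-- The diamagnetic inequality for a weak derivative. -/
theorem HasWeakDirDeriv.exists_modulus {v : Pos M} {f g : L2 M} (h : HasWeakDirDeriv v f g) :
    ∃ g', HasWeakDirDeriv v (modulus f) g' ∧ ‖g'‖ ≤ ‖g‖ := by
  -- The modulus is 1-Lipschitz on `L²` and commutes with translations, so it inherits the
  -- translation estimate of `f`.
  apply exists_weakDirDeriv_of_norm_translate_sub_le
  intro s
  rw [translate_modulus]
  refine (norm_modulus_sub_le _ _).trans ((h.const_smul s).norm_translate_sub_le.trans_eq ?_)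
  rw [norm_smul, Complex.norm_real, Real.norm_eq_abs]

theorem re_inner_le_re_inner_modulus (f g : L2 M) :
    |(inner ℂ f g).re| ≤ (inner ℂ (modulus f) (modulus g)).re := by
  have e : inner ℂ (modulus f) (modulus g) = ((∫ x, ‖f x‖ * ‖g x‖ : ℝ) : ℂ) := by
    rw [L2.inner_def, ← integral_complex_ofReal]
    apply integral_congr_ae
    filter_upwards [modulus_coeFn f, modulus_coeFn g] with x h1 h2
    simp [h1, h2, mul_comm]
  rw [e, Complex.ofReal_re, L2.inner_def]
  refine (Complex.abs_re_le_norm _).trans ((norm_integral_le_integral_norm _).trans_eq ?_)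
  simp [mul_comm]

/-! ### Multiplication by coordinates -/

/-- `g = x_m f` almost everywhere. -/
def IsMulCoord (m : Fin M) (f g : L2 M) : Prop :=
  g =ᵐ[volume] fun x => ((x m : ℝ) : ℂ) * f x

theorem IsMulCoord.unique {m : Fin M} {f g h : L2 M} (h1 : IsMulCoord m f g)
    (h2 : IsMulCoord m f h) : g = h :=
  Lp.ext (h1.trans h2.symm)

theorem IsMulCoord.mulMem {m : Fin M} {f g : L2 M} (h : IsMulCoord m f g) : MulMem m f :=
  (memLp_congr_ae h).1 (Lp.memLp g)

theorem MulMem.isMulCoord {m : Fin M} {f : L2 M} (h : MulMem m f) :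
    IsMulCoord m f (mulCoord m f) := by
  rw [mulCoord, dif_pos h]
  exact h.coeFn_toLp

theorem IsMulCoord.mulCoord_eq {m : Fin M} {f g : L2 M} (h : IsMulCoord m f g) :
    mulCoord m f = g :=
  h.mulMem.isMulCoord.unique h

theorem HasWeakPartial.weakPartial_eq {m : Fin M} {f g : L2 M} (h : HasWeakPartial m f g) :
    weakPartial m f = g := by
  have h' : ∃ g, HasWeakPartial m f g := ⟨g, h⟩
  rw [weakPartial, dif_pos h']
  exact h'.choose_spec.unique h

theorem hasWeakPartial_weakPartial {m : Fin M} {f : L2 M} (h : ∃ g, HasWeakPartial m f g) :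
    HasWeakPartial m f (weakPartial m f) := by
  obtain ⟨g, hg⟩ := h
  rwa [hg.weakPartial_eq]

theorem IsMulCoord.smul {m : Fin M} {f g : L2 M} (h : IsMulCoord m f g) (c : ℂ) :
    IsMulCoord m (c • f) (c • g) := by
  filter_upwards [h, Lp.coeFn_smul c f, Lp.coeFn_smul c g] with x h1 h2 h3
  simp only [h3, h2, Pi.smul_apply, h1, smul_eq_mul]
  ring

theorem HasWeakDirDeriv.smul {v : Pos M} {f g : L2 M} (h : HasWeakDirDeriv v f g) (c : ℂ) :
    HasWeakDirDeriv v (c • f) (c • g) := by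
  rw [hasWeakDirDeriv_iff] at h ⊢
  intro η hη
  rw [inner_smul_right, inner_smul_right, h η hη, mul_neg]

theorem IsMulCoord.inner_comm {m : Fin M} {f g f' g' : L2 M} (h : IsMulCoord m f g)
    (h' : IsMulCoord m f' g') : inner ℂ g f' = inner ℂ f g' := by
  rw [L2.inner_def, L2.inner_def]
  apply integral_congr_ae
  filter_upwards [h, h'] with x h1 h2
  simp only [h1, h2, RCLike.inner_apply, map_mul, Complex.conj_ofReal]
  ring

/-- The correction comes from `x_m = (x + v)_m - v_m`. -/
theorem IsMulCoord.translate {m : Fin M} {f g : L2 M} (h : IsMulCoord m f g) (v : Pos M) :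
    IsMulCoord m (translate v f)
      (Dicke.translate v g - ((v m : ℝ) : ℂ) • Dicke.translate v f) := by
  filter_upwards [translate_coeFn v f, translate_coeFn v g, ae_eq_comp_add h v,
    Lp.coeFn_smul ((v m : ℝ) : ℂ) (Dicke.translate v f),
    Lp.coeFn_sub (Dicke.translate v g) (((v m : ℝ) : ℂ) • Dicke.translate v f)]
    with x h1 h2 h3 h4 h5
  rw [h5, Pi.sub_apply, h4, Pi.smul_apply, h1, h2, h3]
  simp only [PiLp.add_apply, Complex.ofReal_add, smul_eq_mul]
  ring

theorem IsTest.coord_mul {η : Pos M → ℝ} (hη : IsTest η) (m : Fin M) :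
    IsTest fun x => x m * η x :=
  ⟨ContDiff.mul (by fun_prop) hη.1, hη.2.mul_left⟩

/-- The tested form is stable under weak limits. For the converse, `x_m f` is a priori only locally
integrable, which is enough for test functions to determine it. -/
theorem isMulCoord_iff {m : Fin M} {f g : L2 M} :
    IsMulCoord m f g ↔ ∀ η (hη : IsTest η),
      inner ℂ (hη.coord_mul m).toL2 f = inner ℂ hη.toL2 g := by
  constructor
  · intro h η hη
    rw [IsTest.inner_toL2, IsTest.inner_toL2]
    apply integral_congr_ae
    filter_upwards [h] with x hx
    rw [hx]
    push_cast
    ring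
  · intro h
    have hf : LocallyIntegrable (f : Pos M → ℂ) volume :=
      (Lp.memLp f).locallyIntegrable (by norm_num)
    have hm : LocallyIntegrable (fun x : Pos M => ((x m : ℝ) : ℂ) * f x) volume := by
      have hc : Continuous fun x : Pos M => ((x m : ℝ) : ℂ) := by fun_prop
      exact (locallyIntegrableOn_univ.1
        ((locallyIntegrableOn_univ.2 hf).continuousOn_mul hc.continuousOn
          isOpen_univ.isLocallyClosed))
    refine ae_eq_of_integral_contDiff_smul_eq ((Lp.memLp g).locallyIntegrable (by norm_num))
      hm fun η h1 h2 => ?_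
    have := h η ⟨h1, h2⟩
    rw [IsTest.inner_toL2 ⟨h1, h2⟩, IsTest.inner_toL2] at this
    simp only [Complex.real_smul]
    rw [← this]
    congr 1
    ext x
    push_cast
    ring

theorem IsMulCoord.exists_modulus {m : Fin M} {f g : L2 M} (h : IsMulCoord m f g) :
    ∃ g', IsMulCoord m (modulus f) g' ∧ ‖g'‖ = ‖g‖ ∧
      inner ℂ (modulus f) g' = inner ℂ f g := by
  have h1 : MulMem m (modulus f) := by
    refine MemLp.of_le (Lp.memLp g) (f := fun x => ((x m : ℝ) : ℂ) * modulus f x) ?_ ?_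
    · exact (Continuous.aestronglyMeasurable (by fun_prop)).mul (Lp.aestronglyMeasurable _)
    · filter_upwards [h, modulus_coeFn f] with x h1 h2
      simp [h1, h2]
  refine ⟨_, h1.isMulCoord, ?_, ?_⟩
  · apply norm_eq_of_ae_norm_eq
    filter_upwards [h, h1.isMulCoord, modulus_coeFn f] with x h1 h2 h3
    simp [h1, h2, h3]
  · rw [L2.inner_def, L2.inner_def]
    apply integral_congr_ae
    filter_upwards [h, h1.isMulCoord, modulus_coeFn f] with x h1 h2 h3
    simp only [h1, h2, h3, RCLike.inner_apply, Complex.conj_ofReal, mul_assoc]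
    rw [Complex.mul_conj, Complex.normSq_eq_norm_sq]
    push_cast
    ring

/-! ### Closedness under weak limits -/

theorem HasWeakDirDeriv.of_weak_tendsto {v : Pos M} {f g : ℕ → L2 M} {f₀ g₀ : L2 M}
    (h : ∀ n, HasWeakDirDeriv v (f n) (g n))
    (hf : ∀ w, Tendsto (fun n => inner ℂ w (f n)) atTop (𝓝 (inner ℂ w f₀)))
    (hg : ∀ w, Tendsto (fun n => inner ℂ w (g n)) atTop (𝓝 (inner ℂ w g₀))) :
    HasWeakDirDeriv v f₀ g₀ := by
  rw [hasWeakDirDeriv_iff]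
  intro η hη
  refine tendsto_nhds_unique (hf _) ((hg hη.toL2).neg.congr fun n => ?_)
  rw [hasWeakDirDeriv_iff.1 (h n)]

theorem IsMulCoord.of_weak_tendsto {m : Fin M} {f g : ℕ → L2 M} {f₀ g₀ : L2 M}
    (h : ∀ n, IsMulCoord m (f n) (g n))
    (hf : ∀ w, Tendsto (fun n => inner ℂ w (f n)) atTop (𝓝 (inner ℂ w f₀)))
    (hg : ∀ w, Tendsto (fun n => inner ℂ w (g n)) atTop (𝓝 (inner ℂ w g₀))) :
    IsMulCoord m f₀ g₀ := by
  rw [isMulCoord_iff]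
  intro η hη
  refine tendsto_nhds_unique (hf _) ((hg hη.toL2).congr fun n => ?_)
  rw [isMulCoord_iff.1 (h n)]

/-! ### The canonical commutation relation -/

/-- Differentiate the constant `‖f(· + s v)‖²` at `s = 0`. -/
theorem HasWeakDirDeriv.re_inner_self {v : Pos M} {f g : L2 M} (h : HasWeakDirDeriv v f g) :
    (inner ℂ f g).re = 0 := by
  have h1 := h.hasDerivAt.inner ℂ h.hasDerivAt
  simp only [inner_translate, translate_translate, neg_add_cancel, translate_zero, zero_smul]
    at h1
  have h2 := h1.unique (hasDerivAt_const (0 : ℝ) (inner ℂ f f))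
  rw [← inner_conj_symm g f] at h2
  have h3 := congrArg Complex.re h2
  simp only [Complex.add_re, Complex.conj_re, Complex.zero_re] at h3
  linarith

/-- This is `[∂_m, x_m] = 1` in expectation. Since `x_m f` need not have a weak derivative in `L²`,
the derivative is replaced by a difference quotient, for which the identity is exact for each `s ≠
0`, and then `s → 0`. -/
theorem norm_sq_eq_neg_two_re_inner {m : Fin M} {f g d : L2 M} (hg : IsMulCoord m f g)
    (hd : HasWeakDirDeriv (EuclideanSpace.single m 1) f d) :
    ‖f‖ ^ 2 = -2 * (inner ℂ g d).re := by
  set e : Pos M := EuclideanSpace.single m 1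
  have hs := hasDerivAt_iff_tendsto_slope.1 hd.hasDerivAt
  have hid : Tendsto (fun s : ℝ => s) (𝓝[≠] 0) (𝓝 0) := nhdsWithin_le_nhds
  have hc : ∀ u : L2 M, Tendsto (fun s : ℝ => translate (s • e) u) (𝓝[≠] 0) (𝓝 u) := by
    intro u
    have h1 : Continuous fun s : ℝ => translate (s • e) u :=
      continuous_translate.comp (by fun_prop)
    have h2 := h1.tendsto 0
    simp only [zero_smul, translate_zero] at h2
    exact h2.comp hid
  -- The function converging here is `x_m` times the translate of `f`.
  have hx : Tendsto (fun s : ℝ => translate (s • e) g - (s : ℂ) • translate (s • e) f)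
      (𝓝[≠] 0) (𝓝 g) := by
    have h1 : Tendsto (fun s : ℝ => (s : ℂ)) (𝓝[≠] 0) (𝓝 ((0 : ℝ) : ℂ)) :=
      (Complex.continuous_ofReal.tendsto 0).comp hid
    have := (hc g).sub (h1.smul (hc f))
    simpa using this
  have hlim := (hs.inner (𝕜 := ℂ) hx).add ((tendsto_const_nhds (x := g)).inner (𝕜 := ℂ) hs)
  have hconst : ∀ᶠ s : ℝ in 𝓝[≠] 0,
      inner ℂ (slope (fun s : ℝ => translate (s • e) f) 0 s)
        (translate (s • e) g - (s : ℂ) • translate (s • e) f)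
      + inner ℂ g (slope (fun s : ℝ => translate (s • e) f) 0 s) = -((‖f‖ ^ 2 : ℝ) : ℂ) := by
    filter_upwards [self_mem_nhdsWithin] with s hs
    have hs0 : (s : ℂ) ≠ 0 := by simpa using hs
    have hsl : slope (fun s : ℝ => translate (s • e) f) 0 s
        = ((s⁻¹ : ℝ) : ℂ) • (translate (s • e) f - f) := by
      rw [slope_def_module, sub_zero, zero_smul, translate_zero]
      exact (algebraMap_smul ℂ s⁻¹ (translate (s • e) f - f)).symm
    have hmul := hg.translate (s • e)
    have hse : (s • e) m = s := by simp [e]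
    rw [hse] at hmul
    have h1 := hg.inner_comm hmul
    have h2 : inner ℂ (translate (s • e) f)
        (translate (s • e) g - (s : ℂ) • translate (s • e) f)
        = inner ℂ f g - s * ((‖f‖ ^ 2 : ℝ) : ℂ) := by
      rw [inner_sub_right, inner_smul_right, LinearIsometry.inner_map_map,
        LinearIsometry.inner_map_map, inner_self_eq_norm_sq_to_K]
      simp
    have h3 := hg.inner_comm hg
    rw [hsl, inner_smul_left, inner_smul_right, Complex.conj_ofReal, ← mul_add,
      inner_sub_left _ f, h2, inner_sub_right g, ← h1, h3]
    push_cast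
    field_simp
    ring
  have h4 := tendsto_nhds_unique hlim
    (tendsto_const_nhds.congr' (hconst.mono fun s hs => hs.symm))
  rw [← inner_conj_symm d g] at h4
  have h5 := congrArg Complex.re h4
  simp only [Complex.add_re, Complex.conj_re, Complex.neg_re, Complex.ofReal_re] at h5
  linarith

/-- The ground state energy of the one-dimensional harmonic oscillator. -/
theorem norm_sq_le_harmonic {m : Fin M} {f g d : L2 M} (hg : IsMulCoord m f g)
    (hd : HasWeakDirDeriv (EuclideanSpace.single m 1) f d) :
    ‖f‖ ^ 2 ≤ ‖d‖ ^ 2 + ‖g‖ ^ 2 := by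
  have h1 := norm_sq_eq_neg_two_re_inner hg hd
  -- The square completed here is that of the annihilation operator `x_m + ∂_m`.
  have h2 := norm_add_sq (𝕜 := ℂ) g d
  have h3 := sq_nonneg ‖g + d‖
  simp only [RCLike.re_eq_complex_re] at h2
  linarith

end Scalar

/-! ### Compactness in `L²(ℝ^M)` by local averages (Kolmogorov–Riesz). -/

section Compactness

variable {M : ℕ}

theorem enorm_sq_eq_lintegral (f : L2 M) : ‖f‖ₑ ^ 2 = ∫⁻ x, ‖f x‖ₑ ^ 2 := by
  have := eLpNorm_nnreal_pow_eq_lintegral (f := (f : Pos M → ℂ)) (μ := volume) (p := 2) (by simp)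
  rw [Lp.enorm_def]
  simpa using this

/-- The normalized indicator function of a ball around the origin. -/
def ballAverage (M : ℕ) (ε : ℝ) : L2 M :=
  indicatorConstLp 2 (measurableSet_ball (x := (0 : Pos M)) (ε := ε)) measure_ball_lt_top.ne
    (((volume (Metric.ball (0 : Pos M) ε)).toReal⁻¹ : ℝ) : ℂ)

/-- The average of `f` over the ball around `x` is an `L²` pairing, so weak convergence controls it
pointwise in `x`. -/
theorem inner_ballAverage_translate (ε : ℝ) (f : L2 M) (x : Pos M) :
    inner ℂ (ballAverage M ε) (translate x f)
      = ∫ h, f (h + x) ∂(ProbabilityTheory.cond volume (Metric.ball (0 : Pos M) ε)) := by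
  rw [ballAverage, L2.inner_indicatorConstLp_eq_inner_setIntegral,
    ProbabilityTheory.cond, integral_smul_measure]
  have h1 : ∫ h in Metric.ball (0 : Pos M) ε, translate x f h
      = ∫ h in Metric.ball (0 : Pos M) ε, f (h + x) :=
    integral_congr_ae (ae_restrict_of_ae (translate_coeFn x f))
  rw [h1]
  simp [mul_comm]

/-- Jensen's inequality for the uniform probability on the ball, then Tonelli: each shift `h`
contributes `‖f(· + h) - f‖²`. -/
theorem lintegral_sub_ballAverage_le {ε : ℝ} (hε : 0 < ε) (f : L2 M) {C : ℝ}
    (hf : ∀ h ∈ Metric.ball (0 : Pos M) ε, ‖translate h f - f‖ ≤ C) :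
    ∫⁻ x, ‖f x - inner ℂ (ballAverage M ε) (translate x f)‖ₑ ^ 2 ≤ ENNReal.ofReal C ^ 2 := by
  set ν := ProbabilityTheory.cond volume (Metric.ball (0 : Pos M) ε)
  have hpos : volume (Metric.ball (0 : Pos M) ε) ≠ 0 := (Metric.measure_ball_pos _ _ hε).ne'
  have : IsProbabilityMeasure ν := ProbabilityTheory.cond_isProbabilityMeasure_of_finite hpos
    measure_ball_lt_top.ne
  have hm : StronglyMeasurable (f : Pos M → ℂ) := Lp.stronglyMeasurable f
  have hm2 : StronglyMeasurable fun p : Pos M × Pos M => f p.1 - f (p.2 + p.1) :=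
    (hm.comp_measurable measurable_fst).sub
      (hm.comp_measurable (measurable_snd.add measurable_fst))
  have hint : ∀ x, Integrable (fun h => f (h + x)) ν := by
    intro x
    have h1 : LocallyIntegrable (f : Pos M → ℂ) volume :=
      (Lp.memLp f).locallyIntegrable (by norm_num)
    have h2 : IntegrableOn (fun h => f (h + x)) (Metric.ball (0 : Pos M) ε) volume := by
      have h3 := (h1.integrableOn_isCompact (isCompact_closedBall x ε)).mono_set
        Metric.ball_subset_closedBall
      have h4 := (measurePreserving_add_right (volume : Measure (Pos M)) x).integrableOn_comp_preimage
        (measurableEmbedding_addRight x) (f := (f : Pos M → ℂ)) (s := Metric.ball x ε)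
      have h5 : (fun y => y + x) ⁻¹' Metric.ball x ε = Metric.ball (0 : Pos M) ε := by
        ext y; simp [dist_eq_norm]
      rw [h5] at h4
      exact h4.2 h3
    exact h2.smul_measure (by simpa using hpos)
  calc ∫⁻ x, ‖f x - inner ℂ (ballAverage M ε) (translate x f)‖ₑ ^ 2
      ≤ ∫⁻ x, ∫⁻ h, ‖f x - f (h + x)‖ₑ ^ 2 ∂ν := by
        refine lintegral_mono fun x => ?_
        have e : f x - inner ℂ (ballAverage M ε) (translate x f)
            = ∫ h, (f x - f (h + x)) ∂ν := by
          rw [inner_ballAverage_translate, integral_sub (integrable_const _) (hint x)]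
          simp [ν]
        have hs : AEStronglyMeasurable (fun h => f x - f (h + x)) ν :=
          (hm2.comp_measurable measurable_prodMk_left).aestronglyMeasurable
        have h2 : ∫⁻ h, ‖f x - f (h + x)‖ₑ ^ 2 ∂ν
            = eLpNorm (fun h => f x - f (h + x)) 2 ν ^ 2 := by
          have := eLpNorm_nnreal_pow_eq_lintegral (f := fun h => f x - f (h + x)) (μ := ν)
            (p := 2) (by simp)
          simpa using this.symm
        rw [e, h2]
        refine pow_le_pow_left' ((enorm_integral_le_lintegral_enorm _).trans ?_) 2
        rw [← eLpNorm_one_eq_lintegral_enorm]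
        exact eLpNorm_le_eLpNorm_of_exponent_le (by norm_num) hs
    _ = ∫⁻ h, (∫⁻ x, ‖f x - f (h + x)‖ₑ ^ 2) ∂ν := by
        rw [lintegral_lintegral_swap]
        exact (hm2.enorm.pow_const 2).aemeasurable
    _ ≤ ∫⁻ _h, ENNReal.ofReal C ^ 2 ∂ν := by
        refine lintegral_mono_ae ?_
        filter_upwards [ProbabilityTheory.ae_cond_mem measurableSet_ball] with h hh
        have e : ∫⁻ x, ‖f x - f (h + x)‖ₑ ^ 2 = ‖translate h f - f‖ₑ ^ 2 := by
          rw [enorm_sq_eq_lintegral]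
          apply lintegral_congr_ae
          filter_upwards [translate_coeFn h f, Lp.coeFn_sub (translate h f) f] with x h1 h2
          rw [h2, Pi.sub_apply, h1, add_comm h x, ← enorm_neg, neg_sub]
        rw [e]
        refine pow_le_pow_left' ?_ 2
        rw [← ofReal_norm]
        exact ENNReal.ofReal_le_ofReal (hf h hh)
    _ = ENNReal.ofReal C ^ 2 := by simp

/-- Chebyshev: `|f|² ≤ R⁻² ∑ |x_m f|²` where `|x| ≥ R`. -/
theorem lintegral_compl_ball_le {R : ℝ} (hR : 0 < R) {f : L2 M} {g : Fin M → L2 M}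
    (hg : ∀ m, IsMulCoord m f (g m)) {C : ℝ} (hC : ∀ m, ‖g m‖ ≤ C) :
    ∫⁻ x in (Metric.ball (0 : Pos M) R)ᶜ, ‖f x‖ₑ ^ 2
      ≤ ENNReal.ofReal (M * C ^ 2 / R ^ 2) := by
  have h1 : ∀ᵐ x, x ∈ (Metric.ball (0 : Pos M) R)ᶜ →
      ‖f x‖ₑ ^ 2 ≤ ENNReal.ofReal (1 / R ^ 2) * ∑ m, ‖g m x‖ₑ ^ 2 := by
    filter_upwards [ae_all_iff.2 hg] with x hx hxR
    have h2 : R ≤ ‖x‖ := by simpa using hxR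
    have h3 : ‖x‖ ^ 2 = ∑ m, x m ^ 2 := by
      rw [EuclideanSpace.norm_sq_eq]; simp
    have h4 : ‖f x‖ ^ 2 ≤ 1 / R ^ 2 * ∑ m, ‖g m x‖ ^ 2 := by
      simp only [hx, norm_mul, Complex.norm_real, mul_pow, Real.norm_eq_abs, sq_abs]
      rw [← Finset.sum_mul, ← h3, ← mul_assoc]
      have : 1 ≤ 1 / R ^ 2 * ‖x‖ ^ 2 := by
        rw [one_div, le_inv_mul_iff₀ (by positivity), mul_one]
        exact pow_le_pow_left₀ hR.le h2 2
      nlinarith [sq_nonneg ‖f x‖]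
    have h5 := ENNReal.ofReal_le_ofReal h4
    rw [ENNReal.ofReal_mul (by positivity),
      ENNReal.ofReal_sum_of_nonneg fun m _ => by positivity] at h5
    simpa only [ENNReal.ofReal_pow (norm_nonneg _), ofReal_norm] using h5
  calc ∫⁻ x in (Metric.ball (0 : Pos M) R)ᶜ, ‖f x‖ₑ ^ 2
      ≤ ∫⁻ x in (Metric.ball (0 : Pos M) R)ᶜ, ENNReal.ofReal (1 / R ^ 2) * ∑ m, ‖g m x‖ₑ ^ 2 :=
        setLIntegral_mono_ae' measurableSet_ball.compl h1
    _ ≤ ∫⁻ x, ENNReal.ofReal (1 / R ^ 2) * ∑ m, ‖g m x‖ₑ ^ 2 := setLIntegral_le_lintegral _ _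
    _ = ENNReal.ofReal (1 / R ^ 2) * ∑ m, ‖g m‖ₑ ^ 2 := by
        rw [lintegral_const_mul' _ _ ENNReal.ofReal_ne_top, lintegral_finsetSum']
        · simp only [enorm_sq_eq_lintegral]
        · exact fun m _ => (Lp.aestronglyMeasurable (g m)).enorm.pow_const 2
    _ ≤ ENNReal.ofReal (1 / R ^ 2) * ∑ _m : Fin M, ENNReal.ofReal (C ^ 2) := by
        gcongr with m
        rw [← ofReal_norm, ← ENNReal.ofReal_pow (norm_nonneg _)]
        exact ENNReal.ofReal_le_ofReal (pow_le_pow_left₀ (norm_nonneg _) (hC m) 2)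
    _ = ENNReal.ofReal (M * C ^ 2 / R ^ 2) := by
        rw [← ENNReal.ofReal_sum_of_nonneg fun m _ => by positivity,
          ← ENNReal.ofReal_mul (by positivity)]
        congr 1
        simp
        ring

/-- The averages tend to zero pointwise and are uniformly bounded; dominated convergence applies on
a ball of finite volume. -/
theorem tendsto_lintegral_ball_ballAverage {u : ℕ → L2 M} {C : ℝ}
    (hw : ∀ w, Tendsto (fun n => inner ℂ w (u n)) atTop (𝓝 0)) (hn : ∀ n, ‖u n‖ ≤ C)
    (ε R : ℝ) :
    Tendsto (fun n => ∫⁻ x in Metric.ball (0 : Pos M) R,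
      ‖inner ℂ (ballAverage M ε) (translate x (u n))‖ₑ ^ 2) atTop (𝓝 0) := by
  have h0 : ∫⁻ _x in Metric.ball (0 : Pos M) R, (0 : ENNReal) = 0 := by simp
  rw [← h0]
  refine tendsto_lintegral_of_dominated_convergence
    (fun _ => ENNReal.ofReal (‖ballAverage M ε‖ * C) ^ 2) (fun n => ?_) (fun n => ?_) ?_ ?_
  · exact (continuous_const.inner continuous_translate).enorm.measurable.pow_const 2
  · filter_upwards with x
    refine pow_le_pow_left' ?_ 2
    rw [← ofReal_norm]
    refine ENNReal.ofReal_le_ofReal ((norm_inner_le_norm _ _).trans ?_)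
    rw [LinearIsometry.norm_map]
    exact mul_le_mul_of_nonneg_left (hn n) (norm_nonneg _)
  · rw [lintegral_const]
    exact ENNReal.mul_ne_top (ENNReal.pow_ne_top ENNReal.ofReal_ne_top) (by simpa using measure_ball_lt_top.ne)
  · filter_upwards with x
    have h1 := hw (translate (-x) (ballAverage M ε))
    simp only [inner_translate, neg_neg] at h1
    have h2 := ENNReal.Tendsto.pow (n := 2) h1.enorm
    simpa using h2

/-- A weakly null sequence that is equicontinuous under translations and tight is null. -/
theorem tendsto_norm_zero_of_weak {u : ℕ → L2 M} {g : ℕ → Fin M → L2 M} {C : ℝ}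
    (hw : ∀ w, Tendsto (fun n => inner ℂ w (u n)) atTop (𝓝 0)) (hn : ∀ n, ‖u n‖ ≤ C)
    (ht : ∀ n h, ‖translate h (u n) - u n‖ ≤ ‖h‖ * C)
    (hg : ∀ n m, IsMulCoord m (u n) (g n m)) (hC : ∀ n m, ‖g n m‖ ≤ C) :
    Tendsto (fun n => ‖u n‖) atTop (𝓝 0) := by
  have hC0 : 0 ≤ C := (norm_nonneg _).trans (hn 0)
  have key : Tendsto (fun n => ‖u n‖ₑ ^ 2) atTop (𝓝 0) := by
    rw [ENNReal.tendsto_nhds_zero]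
    intro δ hδ
    obtain ⟨d, hd0, hd⟩ : ∃ d : ℝ, 0 < d ∧ ENNReal.ofReal d ≤ δ := by
      rcases eq_or_ne δ ⊤ with rfl | h
      · exact ⟨1, one_pos, le_top⟩
      · exact ⟨δ.toReal, ENNReal.toReal_pos hδ.ne' h, ENNReal.ofReal_toReal_le⟩
    -- The budget `d` is split in thirds: error of averaging, tail outside radius `R`, and averages
    -- inside. The first and third carry the factor 2 of `|a + b|² ≤ 2|a|² + 2|b|²`, hence `d / 6`
    -- below.
    obtain ⟨ε, hε0, hε⟩ : ∃ ε : ℝ, 0 < ε ∧ 2 * (ε * C) ^ 2 ≤ d / 3 := by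
      have h1 : Tendsto (fun ε : ℝ => 2 * (ε * C) ^ 2) (𝓝[>] 0) (𝓝 (2 * (0 * C) ^ 2)) :=
        ((by fun_prop : Continuous fun ε : ℝ => 2 * (ε * C) ^ 2).tendsto 0).mono_left
          nhdsWithin_le_nhds
      have h2 := h1.eventually (gt_mem_nhds (show 2 * (0 * C) ^ 2 < d / 3 by simp; positivity))
      obtain ⟨ε, h3, h4⟩ := (h2.and self_mem_nhdsWithin).exists
      exact ⟨ε, h4, h3.le⟩
    obtain ⟨R, hR0, hR⟩ : ∃ R : ℝ, 0 < R ∧ M * C ^ 2 / R ^ 2 ≤ d / 3 := by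
      have h1 : Tendsto (fun R : ℝ => M * C ^ 2 / R ^ 2) atTop (𝓝 0) :=
        tendsto_const_nhds.div_atTop (tendsto_pow_atTop two_ne_zero)
      obtain ⟨R, h3, h4⟩ := ((h1.eventually (gt_mem_nhds (by positivity : 0 < d / 3))).and
        (eventually_gt_atTop 0)).exists
      exact ⟨R, h4, h3.le⟩
    have h1 := tendsto_lintegral_ball_ballAverage hw hn ε R
    have h2 : ∀ᶠ n in atTop, ∫⁻ x in Metric.ball (0 : Pos M) R,
      ‖inner ℂ (ballAverage M ε) (translate x (u n))‖ₑ ^ 2 ≤ ENNReal.ofReal (d / 6) :=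
      (ENNReal.tendsto_nhds_zero.1 h1) _ (by simpa using hd0)
    filter_upwards [h2] with n h3
    refine le_trans ?_ hd
    have hm : Measurable fun x : Pos M =>
        ‖inner ℂ (ballAverage M ε) (translate x (u n))‖ₑ ^ 2 :=
      (continuous_const.inner continuous_translate).enorm.measurable.pow_const 2
    have h4 := lintegral_sub_ballAverage_le hε0 (u n) (C := ε * C) fun h hh =>
      (ht n h).trans (mul_le_mul_of_nonneg_right (by simpa using (mem_ball_zero_iff.1 hh).le) hC0)
    have h5 := lintegral_compl_ball_le hR0 (hg n) (hC n)
    rw [enorm_sq_eq_lintegral, ← lintegral_add_compl _ (measurableSet_ball (x := (0 : Pos M)) (ε := R))]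
    have h6 : ∫⁻ x in Metric.ball (0 : Pos M) R, ‖u n x‖ₑ ^ 2
        ≤ 2 * ENNReal.ofReal (ε * C) ^ 2 + 2 * ENNReal.ofReal (d / 6) := by
      calc ∫⁻ x in Metric.ball (0 : Pos M) R, ‖u n x‖ₑ ^ 2
          ≤ ∫⁻ x in Metric.ball (0 : Pos M) R,
            (2 * ‖u n x - inner ℂ (ballAverage M ε) (translate x (u n))‖ₑ ^ 2
            + 2 * ‖inner ℂ (ballAverage M ε) (translate x (u n))‖ₑ ^ 2) := by
            refine lintegral_mono fun x => ?_
            set a := inner ℂ (ballAverage M ε) (translate x (u n))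
            have h7 : ‖u n x‖ ^ 2 ≤ 2 * ‖u n x - a‖ ^ 2 + 2 * ‖a‖ ^ 2 := by
              have := norm_le_norm_sub_add (u n x) a
              nlinarith [norm_nonneg (u n x), sq_nonneg (‖u n x - a‖ - ‖a‖)]
            have h8 := ENNReal.ofReal_le_ofReal h7
            rw [ENNReal.ofReal_add (by positivity) (by positivity),
              ENNReal.ofReal_mul (by positivity), ENNReal.ofReal_mul (by positivity)] at h8
            simpa only [ENNReal.ofReal_pow (norm_nonneg _), ofReal_norm,
              ENNReal.ofReal_ofNat] using h8
        _ = 2 * (∫⁻ x in Metric.ball (0 : Pos M) R,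
              ‖u n x - inner ℂ (ballAverage M ε) (translate x (u n))‖ₑ ^ 2)
            + 2 * ∫⁻ x in Metric.ball (0 : Pos M) R,
              ‖inner ℂ (ballAverage M ε) (translate x (u n))‖ₑ ^ 2 := by
            rw [lintegral_add_right _ (hm.const_mul 2), lintegral_const_mul' _ _ (by simp),
              lintegral_const_mul' _ _ (by simp)]
        _ ≤ _ := by
            gcongr
            exact (setLIntegral_le_lintegral _ _).trans h4
    refine (add_le_add h6 h5).trans ?_
    rw [← ENNReal.ofReal_pow (by positivity), ← ENNReal.ofReal_ofNat 2,
      ← ENNReal.ofReal_mul (by positivity), ← ENNReal.ofReal_mul (by positivity),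
      ← ENNReal.ofReal_add (by positivity) (by positivity),
      ← ENNReal.ofReal_add (by positivity) (by positivity)]
    exact ENNReal.ofReal_le_ofReal (by linarith)
  have h1 := (ENNReal.tendsto_toReal ENNReal.zero_ne_top).comp key
  have h2 := h1.sqrt
  simpa using h2

end Compactness

/-! ### The Gaussian ground state of the oscillator. -/

section Gaussian

variable {M : ℕ}

theorem integrable_exp_neg_mul_norm_sq {b : ℝ} (hb : 0 < b) :
    Integrable (fun x : Pos M => Real.exp (-b * ‖x‖ ^ 2)) volume := by
  have := (GaussianFourier.integrable_cexp_neg_mul_sq_norm_add (V := Pos M) (b := (b : ℂ))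
    (by simpa using hb) 0 0).norm
  convert this using 2 with x
  rw [Complex.norm_exp]
  simp [← Complex.ofReal_pow]

/-- The Gaussian `exp (-|x|² / 2)`. -/
def gaussian (M : ℕ) (x : Pos M) : ℝ := Real.exp (-(1 / 2) * ‖x‖ ^ 2)

theorem contDiff_gaussian : ContDiff ℝ (⊤ : ℕ∞) (gaussian M) :=
  Real.contDiff_exp.comp (contDiff_const.mul (contDiff_norm_sq ℝ))

theorem gaussian_sq (x : Pos M) : gaussian M x ^ 2 = Real.exp (-1 * ‖x‖ ^ 2) := by
  rw [gaussian, ← Real.exp_nat_mul]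
  congr 1
  push_cast
  ring

theorem memLp_gaussian : MemLp (fun x => ((gaussian M x : ℝ) : ℂ)) 2 volume := by
  refine MemLp.ofReal (K := ℂ) (f := gaussian M) ?_
  rw [memLp_two_iff_integrable_sq contDiff_gaussian.continuous.aestronglyMeasurable]
  simp only [gaussian_sq]
  exact integrable_exp_neg_mul_norm_sq one_pos

theorem memLp_coord_mul_gaussian (m : Fin M) :
    MemLp (fun x : Pos M => ((x m * gaussian M x : ℝ) : ℂ)) 2 volume := by
  have hc : Continuous fun x : Pos M => x m * gaussian M x :=
    Continuous.mul (by fun_prop) contDiff_gaussian.continuous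
  refine MemLp.ofReal (K := ℂ) (f := fun x : Pos M => x m * gaussian M x) ?_
  rw [memLp_two_iff_integrable_sq hc.aestronglyMeasurable]
  refine Integrable.mono' ((integrable_exp_neg_mul_norm_sq (M := M) (b := 1 / 2)
    (by norm_num)).const_mul 2) (hc.pow 2).aestronglyMeasurable (Eventually.of_forall fun x => ?_)
  have h1 : x m ^ 2 ≤ ‖x‖ ^ 2 := by
    rw [← sq_abs, ← Real.norm_eq_abs]
    exact pow_le_pow_left₀ (norm_nonneg _) (PiLp.norm_apply_le x m) 2
  -- Half of the Gaussian decay absorbs the polynomial factor, as `|x|² ≤ 2 exp (|x|²/2)`.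
  have h2 := Real.add_one_le_exp (1 / 2 * ‖x‖ ^ 2)
  rw [Real.norm_of_nonneg (sq_nonneg _), mul_pow, gaussian_sq]
  have h3 : Real.exp (-(1 / 2) * ‖x‖ ^ 2) = Real.exp (1 / 2 * ‖x‖ ^ 2) * Real.exp (-1 * ‖x‖ ^ 2) := by
    rw [← Real.exp_add]; congr 1; ring
  rw [h3]
  have h4 := Real.exp_pos (-1 * ‖x‖ ^ 2)
  nlinarith

theorem fderiv_gaussian (x : Pos M) (m : Fin M) :
    fderiv ℝ (gaussian M) x (EuclideanSpace.single m 1) = -(x m * gaussian M x) := by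
  have h1 : HasFDerivAt (fun x : Pos M => ‖x‖ ^ 2) (2 • innerSL ℝ x) x :=
    (hasStrictFDerivAt_norm_sq x).hasFDerivAt
  have h2 := (h1.const_mul (-(1 / 2))).exp
  rw [show gaussian M = fun x => Real.exp (-(1 / 2) * ‖x‖ ^ 2) from rfl, h2.fderiv]
  simp [EuclideanSpace.inner_single_right]
  ring

/-- The harmonic oscillator has a normalized ground state `f`, characterized by
`∂_m f = - x_m f`. -/
theorem exists_ground_state (M : ℕ) :
    ∃ (f : L2 M) (g : Fin M → L2 M), ‖f‖ = 1 ∧ (∀ m, IsMulCoord m f (g m)) ∧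
      ∀ m, HasWeakPartial m f (-g m) := by
  let f₀ : L2 M := memLp_gaussian.toLp _
  let g₀ : Fin M → L2 M := fun m => (memLp_coord_mul_gaussian m).toLp _
  have hf₀ : f₀ ≠ 0 := by
    intro h
    have h1 : ∀ᵐ x : Pos M, False := by
      filter_upwards [memLp_gaussian.coeFn_toLp, Lp.coeFn_zero ℂ 2 (volume : Measure (Pos M))]
        with x h1 h2
      rw [show memLp_gaussian.toLp _ = (0 : L2 M) from h, h2] at h1
      exact (Real.exp_pos _).ne' (Complex.ofReal_eq_zero.1 h1.symm)
    exact (NeZero.ne (volume : Measure (Pos M))) (by simpa using h1)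
  have hmul : ∀ m, IsMulCoord m f₀ (g₀ m) := by
    intro m
    filter_upwards [memLp_gaussian.coeFn_toLp, (memLp_coord_mul_gaussian m).coeFn_toLp]
      with x h1 h2
    rw [show g₀ m x = _ from h2, show f₀ x = _ from h1, Complex.ofReal_mul]
  have hder : ∀ m, HasWeakDirDeriv (EuclideanSpace.single m 1) f₀ (-g₀ m) := by
    intro m η hη
    have h1 : ∫ x, ((fderiv ℝ η x (EuclideanSpace.single m 1) : ℝ) : ℂ) * f₀ x
        = ((∫ x, fderiv ℝ η x (EuclideanSpace.single m 1) * gaussian M x : ℝ) : ℂ) := by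
      rw [← integral_complex_ofReal]
      apply integral_congr_ae
      filter_upwards [memLp_gaussian.coeFn_toLp] with x h1
      simp only [f₀, h1, Complex.ofReal_mul]
    have h2 : ∫ x, ((η x : ℝ) : ℂ) * (-g₀ m) x
        = ((∫ x, η x * fderiv ℝ (gaussian M) x (EuclideanSpace.single m 1) : ℝ) : ℂ) := by
      rw [← integral_complex_ofReal]
      apply integral_congr_ae
      filter_upwards [(memLp_coord_mul_gaussian m).coeFn_toLp, Lp.coeFn_neg (g₀ m)] with x h1 h2
      rw [h2, Pi.neg_apply]
      rw [show g₀ m x = _ from h1, fderiv_gaussian, ← Complex.ofReal_neg, ← Complex.ofReal_mul]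
    have hcg := (contDiff_gaussian (M := M)).continuous
    have hcg' : Continuous fun x => fderiv ℝ (gaussian M) x (EuclideanSpace.single m 1) :=
      (contDiff_gaussian.continuous_fderiv (by simp)).clm_apply continuous_const
    have hη' := hη.fderiv_apply (EuclideanSpace.single m 1)
    rw [h1, h2, integral_mul_fderiv_eq_neg_fderiv_mul_of_integrable]
    · push_cast; ring
    · exact (hη'.1.continuous.mul hcg).integrable_of_hasCompactSupport hη'.2.mul_right
    · exact (hη.1.continuous.mul hcg').integrable_of_hasCompactSupport hη.2.mul_right
    · exact (hη.1.continuous.mul hcg).integrable_of_hasCompactSupport hη.2.mul_right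
    · exact fun x _ => hη.1.differentiable (by simp) x
    · exact fun x _ => contDiff_gaussian.differentiable (by simp) x
  refine ⟨((‖f₀‖⁻¹ : ℝ) : ℂ) • f₀, fun m => ((‖f₀‖⁻¹ : ℝ) : ℂ) • g₀ m, ?_, fun m => (hmul m).smul _,
    fun m => ?_⟩
  · rw [norm_smul, Complex.norm_real, norm_inv, norm_norm, inv_mul_cancel₀ (norm_ne_zero_iff.2 hf₀)]
  · rw [hasWeakPartial_iff, ← smul_neg]
    exact (hder m).smul _

end Gaussian

/-! ### Spinor states: expectations in components, displacements, virial identity. -/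

section Spin

variable {N M : ℕ}

/-! ### Pauli matrices in components -/

/-- The eigenvalue of `σ_z` belonging to a spin letter. -/
def spinSign : Fin 2 → ℝ := ![1, -1]

theorem spinSign_sq (i : Fin 2) : spinSign i ^ 2 = 1 := by
  fin_cases i <;> simp [spinSign]

/-- Reversal of the `n`-th spin letter. -/
def flipSpin (n : Fin N) (α : Spin N) : Spin N := Function.update α n (Equiv.swap 0 1 (α n))

theorem flipSpin_flipSpin (n : Fin N) (α : Spin N) : flipSpin n (flipSpin n α) = α := by
  simp [flipSpin]

theorem spinSign_flipSpin (n : Fin N) (α : Spin N) :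
    spinSign (flipSpin n α n) = -spinSign (α n) := by
  rw [flipSpin, Function.update_self]
  generalize α n = i
  fin_cases i <;> simp [spinSign]

theorem flipSpin_apply_of_ne {n k : Fin N} (h : k ≠ n) (α : Spin N) : flipSpin n α k = α k := by
  simp [flipSpin, h]

theorem flipSpin_involutive (n : Fin N) : Function.Involutive (flipSpin n) :=
  flipSpin_flipSpin n

theorem sum_comp_flipSpin {E : Type*} [AddCommMonoid E] (n : Fin N) (f : Spin N → E) :
    ∑ α, f (flipSpin n α) = ∑ α, f α :=
  Equiv.sum_comp (flipSpin_involutive n).toPerm f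

theorem lift_apply (n : Fin N) (A : Matrix (Fin 2) (Fin 2) ℂ) (α β : Spin N) :
    lift n A α β = if ∀ k, k ≠ n → α k = β k then A (α n) (β n) else 0 := by
  rw [lift, Matrix.of_apply]
  split_ifs with h
  · rw [Finset.prod_eq_single n]
    · simp
    · intro k _ hk
      rw [if_neg hk, h k hk, Matrix.one_apply_eq]
    · simp
  · push Not at h
    obtain ⟨k, hk, hne⟩ := h
    exact Finset.prod_eq_zero (Finset.mem_univ k) (by simp [hk, Matrix.one_apply_ne hne])

theorem sigmaZ_apply (n : Fin N) (ψ : State N M) (α : Spin N) :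
    sigmaZ n ψ α = ((spinSign (α n) : ℝ) : ℂ) • ψ α := by
  change ∑ β, lift n pauliZ α β • ψ β = _
  rw [Finset.sum_eq_single α]
  · rw [lift_apply, if_pos fun _ _ => rfl]
    congr 1
    generalize α n = i
    fin_cases i <;> simp [spinSign, pauliZ]
  · intro β _ hβ
    rw [lift_apply]
    split_ifs with h
    · have hn : α n ≠ β n := fun h' => hβ (funext fun k => by
        by_cases hk : k = n
        · rw [hk, h']
        · exact (h k hk).symm)
      have : pauliZ (α n) (β n) = 0 := by
        generalize α n = i at *
        generalize β n = j at *
        fin_cases i <;> fin_cases j <;> simp_all [pauliZ]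
      rw [this, zero_smul]
    · rw [zero_smul]
  · simp

theorem sigmaX_apply (n : Fin N) (ψ : State N M) (α : Spin N) :
    sigmaX n ψ α = ψ (flipSpin n α) := by
  change ∑ β, lift n pauliX α β • ψ β = _
  rw [Finset.sum_eq_single (flipSpin n α)]
  · rw [lift_apply, if_pos fun k hk => (flipSpin_apply_of_ne hk α).symm]
    have : pauliX (α n) (flipSpin n α n) = 1 := by
      rw [flipSpin, Function.update_self]
      generalize α n = i
      fin_cases i <;> simp [pauliX]
    rw [this, one_smul]
  · intro β _ hβ
    rw [lift_apply]
    split_ifs with h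
    · have hn : α n = β n := by
        by_contra hne
        refine hβ (funext fun k => ?_)
        by_cases hk : k = n
        · subst hk
          rw [flipSpin, Function.update_self]
          generalize α k = i at *
          generalize β k = j at *
          fin_cases i <;> fin_cases j <;> simp_all
        · rw [flipSpin_apply_of_ne hk, h k hk]
      have : pauliX (α n) (β n) = 0 := by
        rw [hn]
        generalize β n = j
        fin_cases j <;> simp [pauliX]
      rw [this, zero_smul]
    · rw [zero_smul]
  · simp

/-- The eigenvalue of `(Λ σ_z)_m` belonging to a spin multi-index. -/
def couplingValue (Λ : Matrix (Fin M) (Fin N) ℝ) (α : Spin N) (m : Fin M) : ℝ :=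
  ∑ n, Λ m n * spinSign (α n)

theorem couplingValue_smul (s : ℝ) (Λ : Matrix (Fin M) (Fin N) ℝ) (α : Spin N) (m : Fin M) :
    couplingValue (s • Λ) α m = s * couplingValue Λ α m := by
  simp [couplingValue, Finset.mul_sum, mul_assoc]

theorem couplingZ_apply (Λ : Matrix (Fin M) (Fin N) ℝ) (m : Fin M) (ψ : State N M)
    (α : Spin N) : couplingZ Λ m ψ α = ((couplingValue Λ α m : ℝ) : ℂ) • ψ α := by
  simp only [couplingZ, couplingValue, WithLp.ofLp_sum, Finset.sum_apply, PiLp.smul_apply,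
    sigmaZ_apply, smul_smul, Complex.ofReal_sum, Complex.ofReal_mul, Finset.sum_smul]

theorem tSigmaX_apply (t : Fin N → ℝ) (ψ : State N M) (α : Spin N) :
    tSigmaX t ψ α = ∑ n, (t n : ℂ) • ψ (flipSpin n α) := by
  simp only [tSigmaX, WithLp.ofLp_sum, Finset.sum_apply, PiLp.smul_apply, sigmaX_apply]

theorem state_norm_sq (ψ : State N M) : ‖ψ‖ ^ 2 = ∑ α, ‖ψ α‖ ^ 2 :=
  PiLp.norm_sq_eq_of_L2 _ ψ

theorem re_inner_self (f : L2 M) : (inner ℂ f f).re = ‖f‖ ^ 2 := by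
  rw [inner_self_eq_norm_sq_to_K]
  simp [← Complex.ofReal_pow]

theorem re_inner_real_smul_right (r : ℝ) (f g : L2 M) :
    (inner ℂ f ((r : ℂ) • g)).re = r * (inner ℂ f g).re := by
  rw [inner_smul_right, Complex.re_ofReal_mul]

theorem re_inner_real_smul_left (r : ℝ) (f g : L2 M) :
    (inner ℂ ((r : ℂ) • f) g).re = r * (inner ℂ f g).re := by
  rw [inner_smul_left, Complex.conj_ofReal, Complex.re_ofReal_mul]

theorem re_inner_symm (f g : L2 M) : (inner ℂ f g).re = (inner ℂ g f).re := by
  rw [← inner_conj_symm, Complex.conj_re]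

theorem magnetization_eq (ψ : State N M) (n : Fin N) :
    magnetization ψ n = ∑ α, spinSign (α n) * ‖ψ α‖ ^ 2 := by
  rw [magnetization, PiLp.inner_apply, Complex.re_sum]
  refine Finset.sum_congr rfl fun α _ => ?_
  rw [sigmaZ_apply, re_inner_real_smul_right, re_inner_self]

/-- Weak derivatives `d` and products `x` with the coordinates of the components of `ψ`. -/
structure FormData (ψ : State N M) (d x : Fin M → Spin N → L2 M) : Prop where
  weakPartial : ∀ m α, HasWeakPartial m (ψ α) (d m α)
  isMulCoord : ∀ m α, IsMulCoord m (ψ α) (x m α)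

theorem FormData.mem {ψ : State N M} {d x : Fin M → Spin N → L2 M} (h : FormData ψ d x) :
    ψ ∈ formDomain N M :=
  fun α m => ⟨⟨_, h.weakPartial m α⟩, (h.isMulCoord m α).mulMem⟩

theorem exists_formData {ψ : State N M} (h : ψ ∈ formDomain N M) : ∃ d x, FormData ψ d x :=
  ⟨fun m α => Dicke.weakPartial m (ψ α), fun m α => mulCoord m (ψ α),
    fun m α => hasWeakPartial_weakPartial (h α m).1, fun m α => (h α m).2.isMulCoord⟩

variable {ψ : State N M} {d x : Fin M → Spin N → L2 M}

/-- By uniqueness, explicit witnesses replace `weakPartial` and `mulCoord`, whose default value `0`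
thus never enters. -/
theorem FormData.partialState_apply (h : FormData ψ d x) (m : Fin M) (α : Spin N) :
    partialState m ψ α = d m α :=
  (h.weakPartial m α).weakPartial_eq

theorem FormData.posState_apply (h : FormData ψ d x) (m : Fin M) (α : Spin N) :
    posState m ψ α = x m α :=
  (h.isMulCoord m α).mulCoord_eq

theorem FormData.displacement_eq (h : FormData ψ d x) (m : Fin M) :
    displacement ψ m = ∑ α, (inner ℂ (ψ α) (x m α)).re := by
  rw [displacement, PiLp.inner_apply, Complex.re_sum]
  simp only [h.posState_apply]

theorem FormData.posState_couplingZ_apply (h : FormData ψ d x) (Λ : Matrix (Fin M) (Fin N) ℝ)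
    (m : Fin M) (α : Spin N) :
    posState m (couplingZ Λ m ψ) α = ((couplingValue Λ α m : ℝ) : ℂ) • x m α := by
  change mulCoord m (couplingZ Λ m ψ α) = _
  rw [couplingZ_apply]
  exact ((h.isMulCoord m α).smul _).mulCoord_eq

theorem re_inner_tSigmaX (t : Fin N → ℝ) (ψ : State N M) :
    (inner ℂ ψ (tSigmaX t ψ)).re
      = ∑ n, t n * ∑ α, (inner ℂ (ψ α) (ψ (flipSpin n α))).re := by
  rw [PiLp.inner_apply, Complex.re_sum]
  simp only [tSigmaX_apply, inner_sum, Complex.re_sum, re_inner_real_smul_right, Finset.mul_sum]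
  exact Finset.sum_comm

theorem FormData.energy_eq (h : FormData ψ d x) (Λ : Matrix (Fin M) (Fin N) ℝ)
    (t : Fin N → ℝ) :
    energy Λ t ψ = (∑ m, ∑ α, ‖d m α‖ ^ 2) + (∑ m, ∑ α, ‖x m α‖ ^ 2)
      + (∑ m, ∑ α, couplingValue Λ α m * (inner ℂ (ψ α) (x m α)).re)
      - ∑ n, t n * ∑ α, (inner ℂ (ψ α) (ψ (flipSpin n α))).re := by
  rw [energy, re_inner_tSigmaX]
  simp only [state_norm_sq, h.partialState_apply, h.posState_apply,
    PiLp.inner_apply (𝕜 := ℂ), h.posState_couplingZ_apply, Complex.re_sum,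
    re_inner_real_smul_right]

theorem couplingNormSq_eq (Λ : Matrix (Fin M) (Fin N) ℝ) (ψ : State N M) :
    couplingNormSq Λ ψ = ∑ m, ∑ α, couplingValue Λ α m ^ 2 * ‖ψ α‖ ^ 2 := by
  simp only [couplingNormSq, state_norm_sq, couplingZ_apply, norm_smul, mul_pow,
    Complex.norm_real, Real.norm_eq_abs, sq_abs]

theorem FormData.divCoupling_apply (h : FormData ψ d x) (Λ : Matrix (Fin M) (Fin N) ℝ)
    (σ : Fin N → ℝ) (α : Spin N) :
    divCoupling Λ σ ψ α
      = ∑ m, ((couplingValue Λ α m - (Λ *ᵥ σ) m : ℝ) : ℂ) • d m α := by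
  simp only [divCoupling, WithLp.ofLp_sum, Finset.sum_apply, PiLp.smul_apply, PiLp.sub_apply,
    sigmaZ_apply, h.partialState_apply, ← sub_smul, smul_smul, ← Finset.sum_smul]
  refine Finset.sum_congr rfl fun m _ => ?_
  congr 1
  simp only [couplingValue, Matrix.mulVec, dotProduct, ← Finset.sum_sub_distrib]
  push_cast
  exact Finset.sum_congr rfl fun n _ => by ring

/-- The interaction energy `⟨ψ, x · Λ σ_z ψ⟩`. -/
def interaction (Λ : Matrix (Fin M) (Fin N) ℝ) (ψ : State N M) : ℝ :=
  ∑ m, (inner ℂ ψ (posState m (couplingZ Λ m ψ))).re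

theorem FormData.interaction_eq (h : FormData ψ d x) (Λ : Matrix (Fin M) (Fin N) ℝ) :
    interaction Λ ψ = ∑ m, ∑ α, couplingValue Λ α m * (inner ℂ (ψ α) (x m α)).re := by
  simp only [interaction, PiLp.inner_apply (𝕜 := ℂ), h.posState_couplingZ_apply, Complex.re_sum,
    re_inner_real_smul_right]

/-- Affine dependence on the coupling strength is the source of concavity in `s`. -/
theorem energy_smul (hψ : ψ ∈ formDomain N M) (s : ℝ) (Λ : Matrix (Fin M) (Fin N) ℝ)
    (t : Fin N → ℝ) :
    energy (s • Λ) t ψ = energy 0 t ψ + s * interaction Λ ψ := by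
  obtain ⟨d, x, h⟩ := exists_formData hψ
  have h0 : ∀ (α : Spin N) (m : Fin M), couplingValue (0 : Matrix (Fin M) (Fin N) ℝ) α m = 0 :=
    fun α m => by simp [couplingValue]
  simp only [h.energy_eq, h.interaction_eq, couplingValue_smul, h0, zero_mul,
    Finset.sum_const_zero, Finset.mul_sum, mul_assoc]
  ring

theorem sum_couplingValue_mul_norm_sq (Λ : Matrix (Fin M) (Fin N) ℝ) {σ : Fin N → ℝ}
    (h : magnetization ψ = σ) (m : Fin M) :
    ∑ α, couplingValue Λ α m * ‖ψ α‖ ^ 2 = (Λ *ᵥ σ) m := by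
  simp only [couplingValue, Finset.sum_mul, mulVec, dotProduct, ← h, magnetization_eq,
    Finset.mul_sum, mul_assoc]
  exact Finset.sum_comm

/-! ### Displaced states -/

/-- The state whose component `α` is translated by `v α`. -/
def displace (v : Spin N → Pos M) (ψ : State N M) : State N M :=
  WithLp.toLp 2 fun α => translate (v α) (ψ α)

theorem displace_apply (v : Spin N → Pos M) (ψ : State N M) (α : Spin N) :
    displace v ψ α = translate (v α) (ψ α) := rfl

theorem FormData.displace (h : FormData ψ d x) (v : Spin N → Pos M) :
    FormData (displace v ψ) (fun m α => translate (v α) (d m α))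
      (fun m α => translate (v α) (x m α)
        - ((v α m : ℝ) : ℂ) • translate (v α) (ψ α)) where
  weakPartial m α :=
    hasWeakPartial_iff.2 ((hasWeakPartial_iff.1 (h.weakPartial m α)).translate (v α))
  isMulCoord m α := (h.isMulCoord m α).translate (v α)

theorem norm_displace (v : Spin N → Pos M) (ψ : State N M) : ‖displace v ψ‖ = ‖ψ‖ := by
  rw [← sq_eq_sq₀ (norm_nonneg _) (norm_nonneg _), state_norm_sq, state_norm_sq]
  simp only [displace_apply, LinearIsometry.norm_map]

theorem magnetization_displace (v : Spin N → Pos M) (ψ : State N M) :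
    magnetization (displace v ψ) = magnetization ψ := by
  ext n
  simp only [magnetization_eq, displace_apply, LinearIsometry.norm_map]

theorem re_inner_translate_sub (v : Pos M) (r : ℝ) (f g : L2 M) :
    (inner ℂ (translate v f) (translate v g - (r : ℂ) • translate v f)).re
      = (inner ℂ f g).re - r * ‖f‖ ^ 2 := by
  rw [inner_sub_right, Complex.sub_re, re_inner_real_smul_right, LinearIsometry.inner_map_map,
    re_inner_self, LinearIsometry.norm_map]

theorem norm_translate_sub_sq (v : Pos M) (r : ℝ) (f g : L2 M) :
    ‖translate v g - (r : ℂ) • translate v f‖ ^ 2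
      = ‖g‖ ^ 2 - 2 * r * (inner ℂ f g).re + r ^ 2 * ‖f‖ ^ 2 := by
  rw [norm_sub_sq (𝕜 := ℂ), RCLike.re_eq_complex_re, re_inner_real_smul_right,
    LinearIsometry.inner_map_map, LinearIsometry.norm_map, norm_smul, LinearIsometry.norm_map,
    Complex.norm_real, mul_pow, Real.norm_eq_abs, sq_abs, re_inner_symm]
  ring

theorem FormData.displacement_displace (h : FormData ψ d x) (v : Spin N → Pos M) (m : Fin M) :
    displacement (Dicke.displace v ψ) m = displacement ψ m - ∑ α, v α m * ‖ψ α‖ ^ 2 := by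
  rw [(h.displace v).displacement_eq, h.displacement_eq, ← Finset.sum_sub_distrib]
  simp only [displace_apply, re_inner_translate_sub]

/-- The kinetic term is unchanged and the `x`-dependent terms become polynomial in `v`; only the
tunnelling term feels relative displacements of components. -/
theorem FormData.energy_displace (h : FormData ψ d x) (v : Spin N → Pos M)
    (Λ : Matrix (Fin M) (Fin N) ℝ) (t : Fin N → ℝ) :
    energy Λ t (Dicke.displace v ψ) = (∑ m, ∑ α, ‖d m α‖ ^ 2)
      + (∑ m, ∑ α, (‖x m α‖ ^ 2 - 2 * v α m * (inner ℂ (ψ α) (x m α)).re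
        + v α m ^ 2 * ‖ψ α‖ ^ 2))
      + (∑ m, ∑ α, couplingValue Λ α m *
        ((inner ℂ (ψ α) (x m α)).re - v α m * ‖ψ α‖ ^ 2))
      - ∑ n, t n * ∑ α, (inner ℂ (translate (v α) (ψ α))
        (translate (v (flipSpin n α)) (ψ (flipSpin n α)))).re := by
  rw [(h.displace v).energy_eq]
  simp only [displace_apply, re_inner_translate_sub, norm_translate_sub_sq,
    LinearIsometry.norm_map]

/-! ### The virial identity -/

/-- The derivative of the energy along component-dependent translations. -/
theorem FormData.hasDerivAt_energy_displace (h : FormData ψ d x) (w : Spin N → Pos M)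
    (Λ : Matrix (Fin M) (Fin N) ℝ) (t : Fin N → ℝ) :
    HasDerivAt (fun ε : ℝ => energy Λ t (Dicke.displace (fun α => ε • w α) ψ))
      ((∑ m, ∑ α, -(2 * w α m * (inner ℂ (ψ α) (x m α)).re))
        + (∑ m, ∑ α, -(couplingValue Λ α m * (w α m * ‖ψ α‖ ^ 2)))
        - 2 * ∑ n, t n * ∑ α, (inner ℂ (ψ (flipSpin n α))
          (∑ m, ((w α m : ℝ) : ℂ) • d m α)).re) 0 := by
  simp only [h.energy_displace]
  have hd : ∀ α, HasDerivAt (fun ε : ℝ => translate (ε • w α) (ψ α))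
      (∑ m, ((w α m : ℝ) : ℂ) • d m α) 0 := fun α =>
    (HasWeakPartial.weakDirDeriv_sum (fun m => h.weakPartial m α) (w α)).hasDerivAt
  have h1 : HasDerivAt (fun ε : ℝ => ∑ m, ∑ α, (‖x m α‖ ^ 2
      - 2 * (ε • w α) m * (inner ℂ (ψ α) (x m α)).re + (ε • w α) m ^ 2 * ‖ψ α‖ ^ 2))
      (∑ m, ∑ α, -(2 * w α m * (inner ℂ (ψ α) (x m α)).re)) 0 := by
    refine HasDerivAt.fun_sum fun m _ => HasDerivAt.fun_sum fun α _ => ?_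
    simp only [PiLp.smul_apply, smul_eq_mul]
    have hid := (hasDerivAt_id (0 : ℝ)).mul_const (w α m)
    have := ((((hid.const_mul 2).mul_const (inner ℂ (ψ α) (x m α)).re).const_sub
      (‖x m α‖ ^ 2)).add ((hid.pow 2).mul_const (‖ψ α‖ ^ 2)))
    exact this.congr_deriv (by simp)
  have h2 : HasDerivAt (fun ε : ℝ => ∑ m, ∑ α, couplingValue Λ α m *
      ((inner ℂ (ψ α) (x m α)).re - (ε • w α) m * ‖ψ α‖ ^ 2))
      (∑ m, ∑ α, -(couplingValue Λ α m * (w α m * ‖ψ α‖ ^ 2))) 0 := by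
    refine HasDerivAt.fun_sum fun m _ => HasDerivAt.fun_sum fun α _ => ?_
    simp only [PiLp.smul_apply, smul_eq_mul]
    have hid := (hasDerivAt_id (0 : ℝ)).mul_const (w α m)
    have := ((hid.mul_const (‖ψ α‖ ^ 2)).const_sub (inner ℂ (ψ α) (x m α)).re).const_mul
      (couplingValue Λ α m)
    exact this.congr_deriv (by simp)
  have h3 : HasDerivAt (fun ε : ℝ => ∑ n, t n * ∑ α, (inner ℂ (translate (ε • w α) (ψ α))
        (translate (ε • w (flipSpin n α)) (ψ (flipSpin n α)))).re)
      (2 * ∑ n, t n * ∑ α, (inner ℂ (ψ (flipSpin n α))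
          (∑ m, ((w α m : ℝ) : ℂ) • d m α)).re) 0 := by
    rw [Finset.mul_sum]
    refine HasDerivAt.fun_sum fun n _ => ?_
    rw [mul_left_comm]
    refine HasDerivAt.const_mul _ ?_
    -- The product rule yields one term per factor; reindexing by the spin flip shows that the two
    -- sums agree.
    have e : 2 * ∑ α, (inner ℂ (ψ (flipSpin n α)) (∑ m, ((w α m : ℝ) : ℂ) • d m α)).re
        = ∑ α, (inner ℂ (ψ α) (∑ m, ((w (flipSpin n α) m : ℝ) : ℂ) • d m (flipSpin n α))
          + inner ℂ (∑ m, ((w α m : ℝ) : ℂ) • d m α) (ψ (flipSpin n α))).re := by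
      simp only [Complex.add_re, Finset.sum_add_distrib]
      rw [two_mul]
      congr 1
      · rw [← sum_comp_flipSpin n]
        simp only [flipSpin_flipSpin]
      · exact Finset.sum_congr rfl fun α _ => re_inner_symm _ _
    rw [e]
    refine HasDerivAt.fun_sum fun α _ => ?_
    have h4 := (hd α).inner ℂ (hd (flipSpin n α))
    simp only [zero_smul, translate_zero] at h4
    exact (Complex.reCLM.hasFDerivAt.comp_hasDerivAt (0 : ℝ) h4)
  exact ((h1.const_add _).add h2).sub h3

/-- At an optimizer, stationarity along the translations generated by `∇ · Λ (σ_z - σ)`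
expresses the interaction energy through the adiabatic integrand. -/
theorem IsOptimizer.interaction_eq {Λ : Matrix (Fin M) (Fin N) ℝ} {t σ : Fin N → ℝ} {s : ℝ}
    (hψ : IsOptimizer (s • Λ) t σ 0 ψ) :
    interaction Λ ψ = s / 2 * ((Λ *ᵥ σ) ⬝ᵥ (Λ *ᵥ σ)) - adiabaticIntegrand Λ t σ s ψ := by
  obtain ⟨⟨hdom, hnorm, hmag, hdisp⟩, hmin⟩ := hψ
  obtain ⟨d, x, h⟩ := exists_formData hdom
  let w : Spin N → Pos M := fun α =>
    WithLp.toLp 2 fun m => couplingValue Λ α m - (Λ *ᵥ σ) m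
  have hw : ∀ α m, w α m = couplingValue Λ α m - (Λ *ᵥ σ) m := fun _ _ => rfl
  have hsum : ∑ α, ‖ψ α‖ ^ 2 = 1 := by rw [← state_norm_sq, hnorm, one_pow]
  have hx0 : ∀ m, ∑ α, (inner ℂ (ψ α) (x m α)).re = 0 := fun m => by
    rw [← h.displacement_eq, hdisp]; rfl
  -- The displacement changes by `-ε ∑ w_α ‖ψ^α‖² = -ε (Λσ - Λσ) = 0`.
  have hmem : ∀ ε : ℝ, displace (fun α => ε • w α) ψ ∈ constraintSet σ 0 := by
    intro ε
    refine ⟨(h.displace _).mem, by rw [norm_displace, hnorm],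
      by rw [magnetization_displace, hmag], ?_⟩
    ext m
    rw [h.displacement_displace, hdisp]
    simp only [PiLp.smul_apply, smul_eq_mul, hw, mul_assoc, ← Finset.mul_sum, sub_mul,
      Finset.sum_sub_distrib, sum_couplingValue_mul_norm_sq Λ hmag, hsum]
    simp
  have hloc : IsLocalMin (fun ε : ℝ => energy (s • Λ) t (displace (fun α => ε • w α) ψ)) 0 := by
    refine Eventually.of_forall fun ε => ?_
    have h0 : displace (fun α => (0 : ℝ) • w α) ψ = ψ := by
      ext1 α; simp [displace_apply, translate_zero]
    beta_reduce
    rw [h0]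
    exact hmin (hmem ε)
  have key := hloc.hasDerivAt_eq_zero (h.hasDerivAt_energy_displace w (s • Λ) t)
  -- The constant part `Λσ` of `w` drops out because the displacement vanishes.
  have h1 : ∑ m, ∑ α, -(2 * w α m * (inner ℂ (ψ α) (x m α)).re) = -2 * interaction Λ ψ := by
    rw [h.interaction_eq, Finset.mul_sum]
    refine Finset.sum_congr rfl fun m _ => ?_
    have : ∑ α, (Λ *ᵥ σ) m * (inner ℂ (ψ α) (x m α)).re = 0 := by
      rw [← Finset.mul_sum, hx0, mul_zero]
    rw [← add_zero (-2 * _), ← mul_zero (2 : ℝ), ← this, Finset.mul_sum, Finset.mul_sum,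
      ← Finset.sum_add_distrib]
    refine Finset.sum_congr rfl fun α _ => ?_
    rw [hw]
    ring
  have h2 : ∑ m, ∑ α, -(couplingValue (s • Λ) α m * (w α m * ‖ψ α‖ ^ 2))
      = s * ((Λ *ᵥ σ) ⬝ᵥ (Λ *ᵥ σ)) - s * couplingNormSq Λ ψ := by
    rw [couplingNormSq_eq, dotProduct, Finset.mul_sum, Finset.mul_sum, ← Finset.sum_sub_distrib]
    refine Finset.sum_congr rfl fun m _ => ?_
    rw [← sum_couplingValue_mul_norm_sq Λ hmag m, Finset.mul_sum, Finset.mul_sum, Finset.mul_sum,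
      ← Finset.sum_sub_distrib]
    refine Finset.sum_congr rfl fun α _ => ?_
    rw [hw, couplingValue_smul, sum_couplingValue_mul_norm_sq Λ hmag m]
    ring
  have h3 : ∑ n, t n * ∑ α, (inner ℂ (ψ (flipSpin n α)) (∑ m, ((w α m : ℝ) : ℂ) • d m α)).re
      = (inner ℂ (tSigmaX t ψ) (divCoupling Λ σ ψ)).re := by
    rw [PiLp.inner_apply, Complex.re_sum]
    simp only [h.divCoupling_apply, tSigmaX_apply, sum_inner, Complex.re_sum,
      re_inner_real_smul_left, hw, Finset.mul_sum]
    exact Finset.sum_comm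
  rw [h1, h2, h3] at key
  rw [adiabaticIntegrand]
  linarith

end Spin

/-! ### Reduction to zero displacement, the case `Λ = 0`, real-valued optimizers. -/

section Optimizers

variable {N M : ℕ} {ψ : State N M} {d x : Fin M → Spin N → L2 M}

/-! ### Dependence on the displacement -/

theorem displace_const_mem_constraintSet {σ : Fin N → ℝ} {ξ : Fin M → ℝ}
    (hψ : ψ ∈ constraintSet σ ξ) (v : Fin M → ℝ) :
    displace (fun _ => WithLp.toLp 2 v) ψ ∈ constraintSet σ (ξ - v) := by
  obtain ⟨hdom, hnorm, hmag, hdisp⟩ := hψ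
  obtain ⟨d, x, h⟩ := exists_formData hdom
  refine ⟨(h.displace _).mem, by rw [norm_displace, hnorm],
    by rw [magnetization_displace, hmag], ?_⟩
  ext m
  rw [h.displacement_displace, hdisp, ← Finset.mul_sum, ← state_norm_sq, hnorm]
  simp

/-- All components move together, so the tunnelling term is invariant, and the constraints determine
the whole change. -/
theorem energy_displace_const {σ : Fin N → ℝ} {ξ : Fin M → ℝ}
    (hψ : ψ ∈ constraintSet σ ξ) (Λ : Matrix (Fin M) (Fin N) ℝ) (t : Fin N → ℝ)
    (v : Fin M → ℝ) :
    energy Λ t (displace (fun _ => WithLp.toLp 2 v) ψ)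
      = energy Λ t ψ - 2 * (v ⬝ᵥ ξ) + v ⬝ᵥ v - v ⬝ᵥ (Λ *ᵥ σ) := by
  obtain ⟨hdom, hnorm, hmag, hdisp⟩ := hψ
  obtain ⟨d, x, h⟩ := exists_formData hdom
  have h1 : ∑ m, ∑ α, (‖x m α‖ ^ 2 - 2 * v m * (inner ℂ (ψ α) (x m α)).re
        + v m ^ 2 * ‖ψ α‖ ^ 2) = (∑ m, ∑ α, ‖x m α‖ ^ 2) - 2 * (v ⬝ᵥ ξ) + v ⬝ᵥ v := by
    rw [dotProduct, dotProduct, Finset.mul_sum, ← Finset.sum_sub_distrib,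
      ← Finset.sum_add_distrib]
    refine Finset.sum_congr rfl fun m _ => ?_
    rw [Finset.sum_add_distrib, Finset.sum_sub_distrib, ← Finset.mul_sum, ← Finset.mul_sum,
      ← state_norm_sq, hnorm, ← h.displacement_eq, hdisp]
    ring
  have h2 : ∑ m, ∑ α, couplingValue Λ α m * ((inner ℂ (ψ α) (x m α)).re - v m * ‖ψ α‖ ^ 2)
      = (∑ m, ∑ α, couplingValue Λ α m * (inner ℂ (ψ α) (x m α)).re) - v ⬝ᵥ (Λ *ᵥ σ) := by
    rw [dotProduct, ← Finset.sum_sub_distrib]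
    refine Finset.sum_congr rfl fun m _ => ?_
    rw [← sum_couplingValue_mul_norm_sq Λ hmag m, Finset.mul_sum, ← Finset.sum_sub_distrib]
    exact Finset.sum_congr rfl fun α _ => by ring
  rw [h.energy_displace, h.energy_eq, h1, h2]
  simp only [LinearIsometry.inner_map_map]
  ring

/-- A competitor at `ξ` is translated back to zero displacement; the energy shift is the same for
all states. -/
theorem IsOptimizer.displace_const {Λ : Matrix (Fin M) (Fin N) ℝ} {t σ : Fin N → ℝ}
    (hψ : IsOptimizer Λ t σ 0 ψ) (ξ : Fin M → ℝ) :
    IsOptimizer Λ t σ ξ (displace (fun _ => WithLp.toLp 2 (-ξ)) ψ) := by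
  have hmem := displace_const_mem_constraintSet hψ.1 (-ξ)
  rw [zero_sub, neg_neg] at hmem
  refine ⟨hmem, fun φ hφ => ?_⟩
  have h1 := displace_const_mem_constraintSet hφ ξ
  rw [sub_self] at h1
  have h2 := hψ.2 h1
  simp only [Set.mem_ofPred_eq] at h2 ⊢
  rw [energy_displace_const hφ] at h2
  rw [energy_displace_const hψ.1]
  simp only [neg_dotProduct, dotProduct_neg, dotProduct_zero, mul_zero] at *
  linarith

theorem IsOptimizer.isLeast {Λ : Matrix (Fin M) (Fin N) ℝ} {t σ : Fin N → ℝ} {ξ : Fin M → ℝ}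
    (hψ : IsOptimizer Λ t σ ξ ψ) :
    IsLeast (energy Λ t '' constraintSet σ ξ) (energy Λ t ψ) :=
  ⟨Set.mem_image_of_mem _ hψ.1, by rintro _ ⟨φ, hφ, rfl⟩; exact hψ.2 hφ⟩

theorem IsOptimizer.levyLieb_eq {Λ : Matrix (Fin M) (Fin N) ℝ} {t σ : Fin N → ℝ}
    {ξ : Fin M → ℝ} (hψ : IsOptimizer Λ t σ ξ ψ) : levyLieb Λ t σ ξ = energy Λ t ψ :=
  hψ.isLeast.csInf_eq

theorem IsOptimizer.levyLieb_displaced {Λ : Matrix (Fin M) (Fin N) ℝ} {t σ : Fin N → ℝ}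
    (hψ : IsOptimizer Λ t σ 0 ψ) (ξ : Fin M → ℝ) :
    levyLieb Λ t σ ξ = energy Λ t ψ + ξ ⬝ᵥ ξ + ξ ⬝ᵥ (Λ *ᵥ σ) := by
  rw [(hψ.displace_const ξ).levyLieb_eq, energy_displace_const hψ.1]
  simp only [neg_dotProduct, dotProduct_neg, dotProduct_zero, mul_zero]
  ring

/-! ### The noninteracting energy -/

/-- For a unit vector of spin amplitudes, `⟨σ_x⟩² + ⟨σ_z⟩² ≤ 1`. -/
theorem sum_mul_flipSpin_sq_add_sq_le_one (n : Fin N) {p : Spin N → ℝ}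
    (hp : ∑ α, p α ^ 2 = 1) :
    (∑ α, p α * p (flipSpin n α)) ^ 2 + (∑ α, spinSign (α n) * p α ^ 2) ^ 2 ≤ 1 := by
  set X := ∑ α, p α * p (flipSpin n α) with hX
  set Z := ∑ α, spinSign (α n) * p α ^ 2 with hZ
  -- The operator `A = X σ_x + Z σ_z` has mean `X² + Z²` and, by anticommutation (`h2`), `‖A p‖² =
  -- X² + Z²`. Cauchy–Schwarz gives `(X² + Z²)² ≤ X² + Z²`.
  have h1 : ∑ α, p α * (X * p (flipSpin n α) + Z * (spinSign (α n) * p α)) = X ^ 2 + Z ^ 2 := by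
    have e : X * (∑ α, p α * p (flipSpin n α)) + Z * (∑ α, spinSign (α n) * p α ^ 2)
        = X ^ 2 + Z ^ 2 := by
      rw [← hX, ← hZ, sq, sq]
    rw [← e, Finset.mul_sum, Finset.mul_sum, ← Finset.sum_add_distrib]
    exact Finset.sum_congr rfl fun α _ => by ring
  have h2 : ∑ α, spinSign (α n) * (p α * p (flipSpin n α)) = 0 := by
    have := sum_comp_flipSpin n fun α => spinSign (α n) * (p α * p (flipSpin n α))
    simp only [spinSign_flipSpin, flipSpin_flipSpin, neg_mul, Finset.sum_neg_distrib] at this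
    have e : ∑ α, spinSign (α n) * (p (flipSpin n α) * p α)
        = ∑ α, spinSign (α n) * (p α * p (flipSpin n α)) :=
      Finset.sum_congr rfl fun α _ => by ring
    linarith
  have h3 : ∑ α, (X * p (flipSpin n α) + Z * (spinSign (α n) * p α)) ^ 2 = X ^ 2 + Z ^ 2 := by
    have e : ∀ α : Spin N, (X * p (flipSpin n α) + Z * (spinSign (α n) * p α)) ^ 2
        = X ^ 2 * p (flipSpin n α) ^ 2 + Z ^ 2 * p α ^ 2
          + 2 * X * Z * (spinSign (α n) * (p α * p (flipSpin n α))) := by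
      intro α
      linear_combination Z ^ 2 * p α ^ 2 * spinSign_sq (α n)
    simp only [e, Finset.sum_add_distrib, ← Finset.mul_sum, h2, hp,
      sum_comp_flipSpin n fun α => p α ^ 2]
    ring
  have h4 := Finset.sum_mul_sq_le_sq_mul_sq Finset.univ p
    fun α => X * p (flipSpin n α) + Z * (spinSign (α n) * p α)
  rw [h1, h3, hp, one_mul] at h4
  nlinarith [sq_nonneg X, sq_nonneg Z]

/-- The norms `‖ψ^α‖` serve as spin amplitudes; passing to them keeps the magnetization and can only
enlarge the overlaps. -/
theorem abs_sum_re_inner_flipSpin_le {σ : Fin N → ℝ} (hnorm : ‖ψ‖ = 1)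
    (hmag : magnetization ψ = σ) (n : Fin N) :
    |∑ α, (inner ℂ (ψ α) (ψ (flipSpin n α))).re| ≤ √(1 - σ n ^ 2) := by
  have hp : ∑ α, ‖ψ α‖ ^ 2 = 1 := by rw [← state_norm_sq, hnorm, one_pow]
  have h1 := sum_mul_flipSpin_sq_add_sq_le_one n hp
  rw [← magnetization_eq, hmag] at h1
  refine Real.le_sqrt_of_sq_le ?_
  have h2 : |∑ α, (inner ℂ (ψ α) (ψ (flipSpin n α))).re| ≤ ∑ α, ‖ψ α‖ * ‖ψ (flipSpin n α)‖ :=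
    (Finset.abs_sum_le_sum_abs _ _).trans (Finset.sum_le_sum fun α _ =>
      (Complex.abs_re_le_norm _).trans (norm_inner_le_norm _ _))
  have h3 := pow_le_pow_left₀ (abs_nonneg _) h2 2
  linarith

theorem couplingValue_zero (α : Spin N) (m : Fin M) :
    couplingValue (0 : Matrix (Fin M) (Fin N) ℝ) α m = 0 := by
  simp [couplingValue]

/-- Without coupling the bounds separate: at least 1 from each mode, at least `-|t_n| √(1 - σ_n²)`
from each spin. -/
theorem le_energy_zero {σ : Fin N → ℝ} {ξ : Fin M → ℝ} (hψ : ψ ∈ constraintSet σ ξ)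
    (t : Fin N → ℝ) :
    (M : ℝ) - ∑ n, |t n| * √(1 - σ n ^ 2) ≤ energy 0 t ψ := by
  obtain ⟨hdom, hnorm, hmag, -⟩ := hψ
  obtain ⟨d, x, h⟩ := exists_formData hdom
  have h1 : (M : ℝ) ≤ (∑ m, ∑ α, ‖d m α‖ ^ 2) + ∑ m, ∑ α, ‖x m α‖ ^ 2 := by
    rw [← Finset.sum_add_distrib]
    have : (M : ℝ) = ∑ _m : Fin M, (1 : ℝ) := by simp
    rw [this]
    refine Finset.sum_le_sum fun m _ => ?_
    rw [← one_pow 2, ← hnorm, state_norm_sq, ← Finset.sum_add_distrib]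
    exact Finset.sum_le_sum fun α _ =>
      norm_sq_le_harmonic (h.isMulCoord m α) (hasWeakPartial_iff.1 (h.weakPartial m α))
  have h2 : ∑ n, t n * ∑ α, (inner ℂ (ψ α) (ψ (flipSpin n α))).re
      ≤ ∑ n, |t n| * √(1 - σ n ^ 2) := by
    refine Finset.sum_le_sum fun n _ => (le_abs_self _).trans ?_
    rw [abs_mul]
    exact mul_le_mul_of_nonneg_left (abs_sum_re_inner_flipSpin_le hnorm hmag n) (abs_nonneg _)
  rw [h.energy_eq]
  simp only [couplingValue_zero, zero_mul, Finset.sum_const_zero]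
  linarith

/-- Computes one-spin expectations in a product state, where the other factors are normalized. -/
theorem sum_spin_prod (n : Fin N) (F : Fin N → Fin 2 → ℝ)
    (hF : ∀ k, k ≠ n → F k 0 + F k 1 = 1) :
    ∑ α : Spin N, ∏ k, F k (α k) = F n 0 + F n 1 := by
  have := Finset.prod_univ_sum (fun _ : Fin N => (Finset.univ : Finset (Fin 2))) F
  rw [Fintype.piFinset_univ] at this
  rw [← this]
  simp only [Fin.sum_univ_two]
  exact Finset.prod_eq_single n (fun k _ hk => hF k hk) (by simp)

/-- The amplitudes of the single-spin states with magnetization `σ_n` and `⟨σ_x⟩` of the sign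
of `t_n` and of maximal modulus. -/
def spinAmplitude (t σ : Fin N → ℝ) (n : Fin N) : Fin 2 → ℝ :=
  ![√((1 + σ n) / 2), (if 0 ≤ t n then 1 else -1) * √((1 - σ n) / 2)]

/-- The noninteracting optimizer. -/
theorem exists_energy_zero_eq (t σ : Fin N → ℝ) (hσ : ∀ n, σ n ∈ Set.Icc (-1 : ℝ) 1) :
    ∃ ψ : State N M, ψ ∈ constraintSet σ 0 ∧
      energy 0 t ψ = (M : ℝ) - ∑ n, |t n| * √(1 - σ n ^ 2) := by
  obtain ⟨f, g, hf, hg, hd⟩ := exists_ground_state M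
  set a := spinAmplitude t σ
  have ha0 : ∀ n, a n 0 ^ 2 = (1 + σ n) / 2 := fun n =>
    Real.sq_sqrt (by linarith [(hσ n).1])
  have ha1 : ∀ n, a n 1 ^ 2 = (1 - σ n) / 2 := fun n => by
    change ((if 0 ≤ t n then 1 else -1) * √((1 - σ n) / 2)) ^ 2 = _
    rw [mul_pow, Real.sq_sqrt (by linarith [(hσ n).2])]
    split_ifs <;> ring
  have ha01 : ∀ n, t n * (2 * (a n 0 * a n 1)) = |t n| * √(1 - σ n ^ 2) := fun n => by
    change t n * (2 * (√((1 + σ n) / 2) * ((if 0 ≤ t n then 1 else -1) * √((1 - σ n) / 2)))) = _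
    have h1 : √(1 - σ n ^ 2) = 2 * (√((1 + σ n) / 2) * √((1 - σ n) / 2)) := by
      rw [← Real.sqrt_mul (by linarith [(hσ n).1]),
        show 1 - σ n ^ 2 = 2 ^ 2 * ((1 + σ n) / 2 * ((1 - σ n) / 2)) by ring,
        Real.sqrt_mul (by norm_num), Real.sqrt_sq (by norm_num)]
    rw [h1]
    split_ifs with ht
    · rw [abs_of_nonneg ht]; ring
    · rw [abs_of_neg (not_le.1 ht)]; ring
  let c : Spin N → ℝ := fun α => ∏ n, a n (α n)
  have hc1 : ∑ α, c α ^ 2 = 1 := by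
    simp only [c, ← Finset.prod_pow]
    have := Finset.prod_univ_sum (fun _ : Fin N => (Finset.univ : Finset (Fin 2)))
      fun n i => a n i ^ 2
    rw [Fintype.piFinset_univ] at this
    rw [← this]
    refine Finset.prod_eq_one fun n _ => ?_
    rw [Fin.sum_univ_two, ha0, ha1]
    ring
  have hcz : ∀ n, ∑ α, spinSign (α n) * c α ^ 2 = σ n := by
    intro n
    have h1 : ∀ α : Spin N, spinSign (α n) * c α ^ 2
        = ∏ k, (if k = n then spinSign (α k) else 1) * a k (α k) ^ 2 := by
      intro α
      rw [Finset.prod_mul_distrib, Finset.prod_ite_eq' Finset.univ n, Finset.prod_pow]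
      simp [c]
    simp only [h1]
    rw [sum_spin_prod n fun k i => (if k = n then spinSign i else 1) * a k i ^ 2]
    · simp only [if_true, ha0, ha1, spinSign, Matrix.cons_val_zero, Matrix.cons_val_one]
      ring
    · intro k hk
      simp only [hk, if_false, ha0, ha1]
      ring
  have hcx : ∀ n, ∑ α, c α * c (flipSpin n α) = 2 * (a n 0 * a n 1) := by
    intro n
    have h1 : ∀ α : Spin N, c α * c (flipSpin n α)
        = ∏ k, if k = n then a k 0 * a k 1 else a k (α k) ^ 2 := by
      intro α
      simp only [c, ← Finset.prod_mul_distrib]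
      refine Finset.prod_congr rfl fun k _ => ?_
      split_ifs with hk
      · subst hk
        rw [flipSpin, Function.update_self]
        generalize α k = i
        fin_cases i
        · simp
        · simp [mul_comm]
      · rw [flipSpin_apply_of_ne hk]
        ring
    simp only [h1]
    rw [sum_spin_prod n fun k i => if k = n then a k 0 * a k 1 else a k i ^ 2]
    · simp only [if_true]
      ring
    · intro k hk
      simp only [hk, if_false, ha0, ha1]
      ring
  let ψ : State N M := WithLp.toLp 2 fun α => (c α : ℂ) • f
  have hψ : ∀ α, ψ α = (c α : ℂ) • f := fun _ => rfl
  have h : FormData ψ (fun m α => (c α : ℂ) • -g m) (fun m α => (c α : ℂ) • g m) :=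
    ⟨fun m α => hasWeakPartial_iff.2 ((hasWeakPartial_iff.1 (hd m)).smul _),
      fun m α => (hg m).smul _⟩
  have hψn : ∀ α, ‖ψ α‖ ^ 2 = c α ^ 2 := fun α => by
    rw [hψ, norm_smul, hf, mul_one, Complex.norm_real, Real.norm_eq_abs, sq_abs]
  have hfg : ∀ m, (inner ℂ f (g m)).re = 0 := fun m => by
    have := (hasWeakPartial_iff.1 (hd m)).re_inner_self
    rwa [inner_neg_right, Complex.neg_re, neg_eq_zero] at this
  -- The commutation relation with `∂_m f = -x_m f` gives `1 = 2‖x_m f‖²`; kinetic and potential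
  -- parts then add up to 1 per mode.
  have hgn : ∀ m, ‖g m‖ ^ 2 = 1 / 2 := fun m => by
    have := norm_sq_eq_neg_two_re_inner (hg m) (hasWeakPartial_iff.1 (hd m))
    rw [inner_neg_right, Complex.neg_re, re_inner_self, hf] at this
    linarith
  refine ⟨ψ, ⟨h.mem, ?_, ?_, ?_⟩, ?_⟩
  · rw [← sq_eq_sq₀ (norm_nonneg _) zero_le_one, state_norm_sq, one_pow, ← hc1]
    simp only [hψn]
  · ext n
    simp only [magnetization_eq, hψn, hcz]
  · ext m
    simp only [h.displacement_eq, hψ, re_inner_real_smul_left, re_inner_real_smul_right, hfg,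
      mul_zero, Finset.sum_const_zero, Pi.zero_apply]
  · simp only [h.energy_eq, couplingValue_zero, zero_mul, Finset.sum_const_zero, hψ,
      re_inner_real_smul_left, re_inner_real_smul_right, re_inner_self, hf, norm_smul, norm_neg,
      mul_pow, Complex.norm_real, Real.norm_eq_abs, sq_abs, hgn, ← Finset.sum_mul, hc1]
    have h1 : ∀ n, t n * ∑ α, c (flipSpin n α) * (c α * 1 ^ 2) = |t n| * √(1 - σ n ^ 2) := by
      intro n
      rw [← ha01, ← hcx]
      congr 1
      exact Finset.sum_congr rfl fun α _ => by ring
    simp only [h1]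
    simp
    ring

/-! ### Real-valued optimizers -/

/-- The sign of the spin component `α` in the real-valued state of least energy with given
moduli of the components. -/
def componentSign (t : Fin N → ℝ) (α : Spin N) : ℝ :=
  ∏ n, if t n < 0 then spinSign (α n) else 1

theorem componentSign_sq (t : Fin N → ℝ) (α : Spin N) : componentSign t α ^ 2 = 1 := by
  rw [componentSign, ← Finset.prod_pow]
  refine Finset.prod_eq_one fun n _ => ?_
  split_ifs
  · exact spinSign_sq _
  · exact one_pow 2

/-- These signs gauge every `t_n` to `|t_n|`, after which passing to moduli can only increase the
tunnelling overlaps. -/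
theorem componentSign_flipSpin (t : Fin N → ℝ) (n : Fin N) (α : Spin N) :
    t n * (componentSign t α * componentSign t (flipSpin n α)) = |t n| := by
  have h : componentSign t α * componentSign t (flipSpin n α) = if t n < 0 then -1 else 1 := by
    rw [componentSign, componentSign, ← Finset.prod_mul_distrib, Finset.prod_eq_single n]
    · split_ifs
      · rw [spinSign_flipSpin, mul_neg, ← sq, spinSign_sq]
      · exact one_mul 1
    · intro k _ hk
      rw [flipSpin_apply_of_ne hk]
      split_ifs
      · rw [← sq, spinSign_sq]
      · exact one_mul 1
    · simp
  rw [h]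
  split_ifs with ht
  · rw [abs_of_neg ht, mul_neg_one]
  · rw [abs_of_nonneg (not_lt.1 ht), mul_one]

/-- Replacing the components by their moduli, with suitable signs, does not increase the
energy. -/
theorem IsOptimizer.exists_isRealValued {Λ : Matrix (Fin M) (Fin N) ℝ} {t σ : Fin N → ℝ}
    {ξ : Fin M → ℝ} (hψ : IsOptimizer Λ t σ ξ ψ) :
    ∃ φ : State N M, IsOptimizer Λ t σ ξ φ ∧ IsRealValued φ := by
  obtain ⟨⟨hdom, hnorm, hmag, hdisp⟩, hmin⟩ := hψ
  obtain ⟨d, x, h⟩ := exists_formData hdom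
  choose d' hd' hdn using fun m α => (hasWeakPartial_iff.1 (h.weakPartial m α)).exists_modulus
  choose x' hx' hxn hxi using fun m α => (h.isMulCoord m α).exists_modulus
  let φ : State N M := WithLp.toLp 2 fun α => (componentSign t α : ℂ) • modulus (ψ α)
  have hφ : ∀ α, φ α = (componentSign t α : ℂ) • modulus (ψ α) := fun _ => rfl
  have h' : FormData φ (fun m α => (componentSign t α : ℂ) • d' m α)
      (fun m α => (componentSign t α : ℂ) • x' m α) :=
    ⟨fun m α => hasWeakPartial_iff.2 ((hd' m α).smul _), fun m α => (hx' m α).smul _⟩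
  have hns : ∀ (α : Spin N) (f : L2 M), ‖(componentSign t α : ℂ) • f‖ ^ 2 = ‖f‖ ^ 2 := by
    intro α f
    rw [norm_smul, Complex.norm_real, mul_pow, Real.norm_eq_abs, sq_abs, componentSign_sq, one_mul]
  have hφn : ∀ α, ‖φ α‖ ^ 2 = ‖ψ α‖ ^ 2 := fun α => by rw [hφ, hns, norm_modulus]
  have hφx : ∀ m α, (inner ℂ (φ α) ((componentSign t α : ℂ) • x' m α)).re
      = (inner ℂ (ψ α) (x m α)).re := by
    intro m α
    rw [hφ, re_inner_real_smul_left, re_inner_real_smul_right, hxi, ← mul_assoc, ← sq,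
      componentSign_sq, one_mul]
  have hmem : φ ∈ constraintSet σ ξ := by
    refine ⟨h'.mem, ?_, ?_, ?_⟩
    · rw [← sq_eq_sq₀ (norm_nonneg _) zero_le_one, state_norm_sq, one_pow]
      simp only [hφn]
      rw [← state_norm_sq, hnorm, one_pow]
    · rw [← hmag]
      ext n
      simp only [magnetization_eq, hφn]
    · rw [← hdisp]
      ext m
      simp only [h.displacement_eq, h'.displacement_eq, hφx]
  refine ⟨φ, ⟨hmem, fun χ hχ => ?_⟩, fun α => ?_⟩
  · refine le_trans (b := energy Λ t ψ) ?_ (hmin hχ)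
    rw [h.energy_eq, h'.energy_eq]
    simp only [hφx, hns, hxn]
    have h1 : ∑ m, ∑ α, ‖d' m α‖ ^ 2 ≤ ∑ m, ∑ α, ‖d m α‖ ^ 2 :=
      Finset.sum_le_sum fun m _ => Finset.sum_le_sum fun α _ =>
        pow_le_pow_left₀ (norm_nonneg _) (hdn m α) 2
    have h2 : ∑ n, t n * ∑ α, (inner ℂ (ψ α) (ψ (flipSpin n α))).re
        ≤ ∑ n, t n * ∑ α, (inner ℂ (φ α) (φ (flipSpin n α))).re := by
      refine Finset.sum_le_sum fun n _ => ?_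
      rw [Finset.mul_sum, Finset.mul_sum]
      refine Finset.sum_le_sum fun α _ => ?_
      rw [hφ, hφ, re_inner_real_smul_left, re_inner_real_smul_right, ← mul_assoc, ← mul_assoc,
        mul_assoc (t n), componentSign_flipSpin]
      refine (le_abs_self _).trans ?_
      rw [abs_mul]
      exact mul_le_mul_of_nonneg_left (re_inner_le_re_inner_modulus _ _) (abs_nonneg _)
    linarith
  · filter_upwards [Lp.coeFn_smul (componentSign t α : ℂ) (modulus (ψ α)),
      modulus_coeFn (ψ α)] with y h1 h2
    rw [hφ, h1, Pi.smul_apply, h2, smul_eq_mul, ← Complex.ofReal_mul, Complex.ofReal_im]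

end Optimizers

/-! ### The direct method: coercivity, compact embedding, lower semicontinuity. -/

section Existence

variable {N M : ℕ} {ψ : State N M} {d x : Fin M → Spin N → L2 M}

/-! ### Existence of optimizers -/

/-- A bound on the interaction and tunnelling energies relative to the harmonic energy. -/
def energyBound (Λ : Matrix (Fin M) (Fin N) ℝ) (t : Fin N → ℝ) : ℝ :=
  (∑ m, ∑ α, couplingValue Λ α m ^ 2 / 2) + ∑ n, |t n| * ∑ _α : Spin N, (1 : ℝ)

theorem norm_component_le (ψ : State N M) (α : Spin N) : ‖ψ α‖ ≤ ‖ψ‖ :=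
  PiLp.norm_apply_le ψ α

/-- Coercivity: Young's inequality spends half of `‖xψ‖²` on the coupling, and each tunnelling
overlap is at most 1 in modulus. -/
theorem FormData.le_energy (h : FormData ψ d x) (hnorm : ‖ψ‖ = 1)
    (Λ : Matrix (Fin M) (Fin N) ℝ) (t : Fin N → ℝ) :
    (∑ m, ∑ α, ‖d m α‖ ^ 2) + (∑ m, ∑ α, ‖x m α‖ ^ 2) / 2 - energyBound Λ t
      ≤ energy Λ t ψ := by
  have hle : ∀ α, ‖ψ α‖ ≤ 1 := fun α => hnorm ▸ norm_component_le ψ α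
  have h1 : -((∑ m, ∑ α, ‖x m α‖ ^ 2) / 2 + ∑ m, ∑ α, couplingValue Λ α m ^ 2 / 2)
      ≤ ∑ m, ∑ α, couplingValue Λ α m * (inner ℂ (ψ α) (x m α)).re := by
    rw [Finset.sum_div, ← Finset.sum_add_distrib, ← Finset.sum_neg_distrib]
    refine Finset.sum_le_sum fun m _ => ?_
    rw [Finset.sum_div, ← Finset.sum_add_distrib, ← Finset.sum_neg_distrib]
    refine Finset.sum_le_sum fun α _ => ?_
    have h2 : |(inner ℂ (ψ α) (x m α)).re| ≤ ‖x m α‖ := by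
      refine (Complex.abs_re_le_norm _).trans ((norm_inner_le_norm _ _).trans ?_)
      exact mul_le_of_le_one_left (norm_nonneg _) (hle α)
    have h3 := pow_le_pow_left₀ (abs_nonneg _) h2 2
    rw [sq_abs] at h3
    nlinarith [sq_nonneg (couplingValue Λ α m + (inner ℂ (ψ α) (x m α)).re)]
  have h2 : ∑ n, t n * ∑ α, (inner ℂ (ψ α) (ψ (flipSpin n α))).re
      ≤ ∑ n, |t n| * ∑ _α : Spin N, (1 : ℝ) := by
    refine Finset.sum_le_sum fun n _ => (le_abs_self _).trans ?_
    rw [abs_mul]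
    refine mul_le_mul_of_nonneg_left ?_ (abs_nonneg _)
    refine (Finset.abs_sum_le_sum_abs _ _).trans (Finset.sum_le_sum fun α _ => ?_)
    exact (Complex.abs_re_le_norm _).trans ((norm_inner_le_norm _ _).trans
      (mul_le_one₀ (hle _) (norm_nonneg _) (hle _)))
  rw [h.energy_eq, energyBound]
  linarith

theorem tendsto_inner_of_tendsto_of_weak {f g : ℕ → L2 M} {f₀ g₀ : L2 M} {C : ℝ}
    (hf : Tendsto f atTop (𝓝 f₀)) (hC : ∀ n, ‖g n‖ ≤ C)
    (hg : ∀ w, Tendsto (fun n => inner ℂ w (g n)) atTop (𝓝 (inner ℂ w g₀))) :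
    Tendsto (fun n => inner ℂ (f n) (g n)) atTop (𝓝 (inner ℂ f₀ g₀)) := by
  have h1 : Tendsto (fun n => inner ℂ (f n - f₀) (g n)) atTop (𝓝 0) := by
    refine squeeze_zero_norm (a := fun n => ‖f n - f₀‖ * C) (fun n => ?_) ?_
    · exact (norm_inner_le_norm _ _).trans (mul_le_mul_of_nonneg_left (hC n) (norm_nonneg _))
    · have := (tendsto_iff_norm_sub_tendsto_zero.1 hf).mul_const C
      rwa [zero_mul] at this
  have h2 := h1.add (hg f₀)
  rw [zero_add] at h2
  refine h2.congr fun n => ?_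
  rw [← inner_add_left, sub_add_cancel]

theorem norm_translate_sub_le_of_weakPartial {f : L2 M} {g : Fin M → L2 M} {C : ℝ}
    (h : ∀ m, HasWeakPartial m f (g m)) (hC : ∀ m, ‖g m‖ ≤ C) (v : Pos M) :
    ‖translate v f - f‖ ≤ ‖v‖ * (M * C) := by
  refine (HasWeakPartial.weakDirDeriv_sum h v).norm_translate_sub_le.trans ?_
  refine (norm_sum_le _ _).trans ?_
  have : ∀ m ∈ Finset.univ, ‖((v m : ℝ) : ℂ) • g m‖ ≤ ‖v‖ * C := by
    intro m _
    rw [norm_smul, Complex.norm_real]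
    exact mul_le_mul (PiLp.norm_apply_le v m) (hC m) (norm_nonneg _) (norm_nonneg _)
  refine (Finset.sum_le_card_nsmul _ _ _ this).trans_eq ?_
  simp
  ring

theorem IsMulCoord.sub {m : Fin M} {f g f' g' : L2 M} (h : IsMulCoord m f g)
    (h' : IsMulCoord m f' g') : IsMulCoord m (f - f') (g - g') := by
  filter_upwards [h, h', Lp.coeFn_sub f f', Lp.coeFn_sub g g'] with y h1 h2 h3 h4
  rw [h3, h4, Pi.sub_apply, Pi.sub_apply, h1, h2]
  ring

/-- The embedding of the harmonic oscillator form domain in `L²` is compact: weakly convergent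
sequences with bounded derivatives and moments converge. -/
theorem tendsto_of_weak_tendsto_of_bounded {f : ℕ → L2 M} {f₀ : L2 M}
    {d x : ℕ → Fin M → L2 M} {d₀ x₀ : Fin M → L2 M} {C : ℝ}
    (hf : ∀ w, Tendsto (fun n => inner ℂ w (f n)) atTop (𝓝 (inner ℂ w f₀)))
    (hd : ∀ n m, HasWeakPartial m (f n) (d n m)) (hx : ∀ n m, IsMulCoord m (f n) (x n m))
    (hd₀ : ∀ m, HasWeakPartial m f₀ (d₀ m)) (hx₀ : ∀ m, IsMulCoord m f₀ (x₀ m))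
    (hfC : ∀ n, ‖f n‖ ≤ C) (hdC : ∀ n m, ‖d n m‖ ≤ C) (hxC : ∀ n m, ‖x n m‖ ≤ C)
    (hfC₀ : ‖f₀‖ ≤ C) (hdC₀ : ∀ m, ‖d₀ m‖ ≤ C) (hxC₀ : ∀ m, ‖x₀ m‖ ≤ C) :
    Tendsto f atTop (𝓝 f₀) := by
  have hC : 0 ≤ C := (norm_nonneg _).trans hfC₀
  have hMC : 0 ≤ (M : ℝ) * C := by positivity
  rw [tendsto_iff_norm_sub_tendsto_zero]
  -- One constant must dominate `2C`, for norms and moments of the differences, and `2MC`, for their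
  -- translations.
  refine tendsto_norm_zero_of_weak (u := fun n => f n - f₀) (g := fun n m => x n m - x₀ m)
    (C := (2 * M + 2) * C) (fun w => ?_) (fun n => ?_) (fun n v => ?_)
    (fun n m => (hx n m).sub (hx₀ m)) fun n m => ?_
  · have := (hf w).sub_const (inner ℂ w f₀)
    rw [sub_self] at this
    exact this.congr fun n => (inner_sub_right _ _ _).symm
  · refine (norm_sub_le _ _).trans ?_
    nlinarith [hfC n]
  · have h1 := norm_translate_sub_le_of_weakPartial (hd n) (hdC n) v
    have h2 := norm_translate_sub_le_of_weakPartial hd₀ hdC₀ v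
    rw [map_sub, sub_sub_sub_comm]
    refine (norm_sub_le _ _).trans ((add_le_add h1 h2).trans ?_)
    nlinarith [norm_nonneg v, mul_nonneg (norm_nonneg v) hC]
  · refine (norm_sub_le _ _).trans ?_
    nlinarith [hxC n m, hxC₀ m]

theorem bddBelow_energy_image (Λ : Matrix (Fin M) (Fin N) ℝ) (t σ : Fin N → ℝ)
    (ξ : Fin M → ℝ) : BddBelow (energy Λ t '' constraintSet σ ξ) := by
  refine ⟨-energyBound Λ t, ?_⟩
  rintro _ ⟨ψ, hψ, rfl⟩
  obtain ⟨d, x, h⟩ := exists_formData hψ.1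
  have h1 := h.le_energy hψ.2.1 Λ t
  have h2 : 0 ≤ ∑ m, ∑ α, ‖d m α‖ ^ 2 := by positivity
  have h3 : 0 ≤ ∑ m, ∑ α, ‖x m α‖ ^ 2 := by positivity
  linarith

theorem norm_sq_le_sum_sum (d : Fin M → Spin N → L2 M) (m : Fin M) (α : Spin N) :
    ‖d m α‖ ^ 2 ≤ ∑ m, ∑ α, ‖d m α‖ ^ 2 :=
  (Finset.single_le_sum (f := fun α => ‖d m α‖ ^ 2) (fun _ _ => sq_nonneg _)
    (Finset.mem_univ α)).trans
    (Finset.single_le_sum (f := fun m => ∑ α, ‖d m α‖ ^ 2) (fun _ _ => by positivity)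
      (Finset.mem_univ m))

/-- The tangent of `‖·‖²` at `f` is weakly continuous in `g`; it yields lower semicontinuity without
a `liminf`. -/
theorem two_re_inner_sub_norm_sq_le (f g : L2 M) :
    2 * (inner ℂ f g).re - ‖f‖ ^ 2 ≤ ‖g‖ ^ 2 := by
  have h1 := norm_sub_sq (𝕜 := ℂ) f g
  rw [RCLike.re_eq_complex_re] at h1
  linarith [sq_nonneg ‖f - g‖]

/-- The infimum of the Levy-Lieb functional is attained. -/
theorem exists_isOptimizer (Λ : Matrix (Fin M) (Fin N) ℝ) (t σ : Fin N → ℝ)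
    (ξ : Fin M → ℝ) (hne : (constraintSet (N := N) (M := M) σ ξ).Nonempty) :
    ∃ ψ : State N M, IsOptimizer Λ t σ ξ ψ := by
  have hbdd := bddBelow_energy_image Λ t σ ξ
  obtain ⟨u, -, hu, hmem⟩ := exists_seq_tendsto_sInf (hne.image (energy Λ t)) hbdd
  choose ψ hψ hψu using hmem
  obtain ⟨E, hE⟩ := hu.bddAbove_range
  have hE' : ∀ n, energy Λ t (ψ n) ≤ E := fun n => hψu n ▸ hE ⟨n, rfl⟩
  choose d x h using fun n => exists_formData (hψ n).1
  -- The factor 2 compensates the half of `‖xψ‖²` left by coercivity; `1 ≤ C` also covers the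
  -- normalized components.
  obtain ⟨C, hC0, hC⟩ : ∃ C : ℝ, 1 ≤ C ∧ 2 * (E + energyBound Λ t) ≤ C ^ 2 := by
    refine ⟨max 1 (2 * (E + energyBound Λ t)), le_max_left _ _, ?_⟩
    nlinarith [le_max_left 1 (2 * (E + energyBound Λ t)),
      le_max_right 1 (2 * (E + energyBound Λ t))]
  have hψC : ∀ n α, ‖ψ n α‖ ≤ C := fun n α =>
    ((norm_component_le _ _).trans_eq (hψ n).2.1).trans hC0
  have hdC : ∀ n m α, ‖d n m α‖ ≤ C := fun n m α => by
    have h1 := (h n).le_energy (hψ n).2.1 Λ t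
    have h2 : 0 ≤ ∑ m, ∑ α, ‖d n m α‖ ^ 2 := by positivity
    have h3 : 0 ≤ ∑ m, ∑ α, ‖x n m α‖ ^ 2 := by positivity
    have h4 := norm_sq_le_sum_sum (d n) m α
    exact le_of_sq_le_sq (by linarith [hE' n]) (by linarith)
  have hxC : ∀ n m α, ‖x n m α‖ ≤ C := fun n m α => by
    have h1 := (h n).le_energy (hψ n).2.1 Λ t
    have h2 : 0 ≤ ∑ m, ∑ α, ‖d n m α‖ ^ 2 := by positivity
    have h4 := norm_sq_le_sum_sum (x n) m α
    exact le_of_sq_le_sq (by linarith [hE' n]) (by linarith)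
  obtain ⟨l, φ, hφ, hl⟩ := exists_subseq_weak_tendsto_family (M := M)
    (ι := Spin N ⊕ (Fin M × Spin N) ⊕ (Fin M × Spin N))
    (u := Sum.elim (fun α n => ψ n α)
      (Sum.elim (fun p n => d n p.1 p.2) (fun p n => x n p.1 p.2))) (C := C) (by
      rintro (α | p | p) n
      · exact hψC n α
      · exact hdC n p.1 p.2
      · exact hxC n p.1 p.2)
  let ψ₀ : State N M := WithLp.toLp 2 fun α => l (Sum.inl α)
  let d₀ : Fin M → Spin N → L2 M := fun m α => l (Sum.inr (Sum.inl (m, α)))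
  let x₀ : Fin M → Spin N → L2 M := fun m α => l (Sum.inr (Sum.inr (m, α)))
  have hψw : ∀ α w, Tendsto (fun n => inner ℂ w (ψ (φ n) α)) atTop (𝓝 (inner ℂ w (ψ₀ α))) :=
    fun α => hl (Sum.inl α)
  have hdw : ∀ m α w, Tendsto (fun n => inner ℂ w (d (φ n) m α)) atTop
      (𝓝 (inner ℂ w (d₀ m α))) := fun m α => hl (Sum.inr (Sum.inl (m, α)))
  have hxw : ∀ m α w, Tendsto (fun n => inner ℂ w (x (φ n) m α)) atTop
      (𝓝 (inner ℂ w (x₀ m α))) := fun m α => hl (Sum.inr (Sum.inr (m, α)))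
  have h₀ : FormData ψ₀ d₀ x₀ :=
    ⟨fun m α => hasWeakPartial_iff.2 (HasWeakDirDeriv.of_weak_tendsto
        (fun n => hasWeakPartial_iff.1 ((h (φ n)).weakPartial m α)) (hψw α) (hdw m α)),
      fun m α => IsMulCoord.of_weak_tendsto (fun n => (h (φ n)).isMulCoord m α)
        (hψw α) (hxw m α)⟩
  have hψs : ∀ α, Tendsto (fun n => ψ (φ n) α) atTop (𝓝 (ψ₀ α)) := fun α =>
    tendsto_of_weak_tendsto_of_bounded (hψw α)
      (fun n m => (h (φ n)).weakPartial m α) (fun n m => (h (φ n)).isMulCoord m α)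
      (fun m => h₀.weakPartial m α) (fun m => h₀.isMulCoord m α)
      (fun n => hψC _ α) (fun n m => hdC _ m α) (fun n m => hxC _ m α)
      (norm_le_of_weak_tendsto (fun n => hψC (φ n) α) (hψw α _))
      (fun m => norm_le_of_weak_tendsto (fun n => hdC (φ n) m α) (hdw m α _))
      (fun m => norm_le_of_weak_tendsto (fun n => hxC (φ n) m α) (hxw m α _))
  have hre : ∀ {z : ℕ → ℂ} {z₀ : ℂ}, Tendsto z atTop (𝓝 z₀) →
      Tendsto (fun n => (z n).re) atTop (𝓝 z₀.re) := fun hz =>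
    (Complex.continuous_re.tendsto _).comp hz
  -- Strong convergence of components against weak convergence of moments: the displacement
  -- constraint and the coupling energy pass to the limit.
  have hψx : ∀ m α, Tendsto (fun n => (inner ℂ (ψ (φ n) α) (x (φ n) m α)).re) atTop
      (𝓝 (inner ℂ (ψ₀ α) (x₀ m α)).re) := fun m α =>
    hre (tendsto_inner_of_tendsto_of_weak (hψs α) (fun n => hxC (φ n) m α) (hxw m α))
  have hmem₀ : ψ₀ ∈ constraintSet σ ξ := by
    refine ⟨h₀.mem, ?_, ?_, ?_⟩
    · have h1 : Tendsto (fun n => ∑ α, ‖ψ (φ n) α‖ ^ 2) atTop (𝓝 (∑ α, ‖ψ₀ α‖ ^ 2)) :=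
        tendsto_finsetSum _ fun α _ => (hψs α).norm.pow 2
      simp only [← state_norm_sq, (hψ _).2.1] at h1
      have h2 := tendsto_nhds_unique h1 tendsto_const_nhds
      exact (sq_eq_sq₀ (norm_nonneg _) zero_le_one).1 h2
    · ext n
      have h1 : Tendsto (fun k => ∑ α, spinSign (α n) * ‖ψ (φ k) α‖ ^ 2) atTop
          (𝓝 (∑ α, spinSign (α n) * ‖ψ₀ α‖ ^ 2)) :=
        tendsto_finsetSum _ fun α _ => ((hψs α).norm.pow 2).const_mul _
      simp only [← magnetization_eq, (hψ _).2.2.1] at h1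
      exact tendsto_nhds_unique h1 tendsto_const_nhds
    · ext m
      have h1 : Tendsto (fun k => ∑ α, (inner ℂ (ψ (φ k) α) (x (φ k) m α)).re) atTop
          (𝓝 (∑ α, (inner ℂ (ψ₀ α) (x₀ m α)).re)) :=
        tendsto_finsetSum _ fun α _ => hψx m α
      simp only [← (h _).displacement_eq, ← h₀.displacement_eq, (hψ _).2.2.2] at h1
      exact tendsto_nhds_unique h1 tendsto_const_nhds
  -- A minorant of the energy along the sequence: both quadratic terms are replaced by their
  -- tangents at the limit.
  have hlow : Tendsto (fun n =>
      (∑ m, ∑ α, (2 * (inner ℂ (d₀ m α) (d (φ n) m α)).re - ‖d₀ m α‖ ^ 2))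
      + (∑ m, ∑ α, (2 * (inner ℂ (x₀ m α) (x (φ n) m α)).re - ‖x₀ m α‖ ^ 2))
      + (∑ m, ∑ α, couplingValue Λ α m * (inner ℂ (ψ (φ n) α) (x (φ n) m α)).re)
      - ∑ k, t k * ∑ α, (inner ℂ (ψ (φ n) α) (ψ (φ n) (flipSpin k α))).re) atTop
      (𝓝 (energy Λ t ψ₀)) := by
    have hself : ∀ f : L2 M, ‖f‖ ^ 2 = 2 * (inner ℂ f f).re - ‖f‖ ^ 2 := fun f => by
      rw [re_inner_self]; ring
    have e1 : ∑ m, ∑ α, ‖d₀ m α‖ ^ 2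
        = ∑ m, ∑ α, (2 * (inner ℂ (d₀ m α) (d₀ m α)).re - ‖d₀ m α‖ ^ 2) := by
      simp only [← hself]
    have e2 : ∑ m, ∑ α, ‖x₀ m α‖ ^ 2
        = ∑ m, ∑ α, (2 * (inner ℂ (x₀ m α) (x₀ m α)).re - ‖x₀ m α‖ ^ 2) := by
      simp only [← hself]
    rw [h₀.energy_eq, e1, e2]
    refine ((Tendsto.add (tendsto_finsetSum _ fun m _ => tendsto_finsetSum _ fun α _ => ?_)
      (tendsto_finsetSum _ fun m _ => tendsto_finsetSum _ fun α _ => ?_)).add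
      (tendsto_finsetSum _ fun m _ => tendsto_finsetSum _ fun α _ => ?_)).sub
      (tendsto_finsetSum _ fun k _ => Tendsto.const_mul _ (tendsto_finsetSum _ fun α _ => ?_))
    · exact ((hre (hdw m α _)).const_mul 2).sub_const _
    · exact ((hre (hxw m α _)).const_mul 2).sub_const _
    · exact (hψx m α).const_mul _
    · exact hre ((hψs α).inner (𝕜 := ℂ) (hψs (flipSpin k α)))
  have hle : energy Λ t ψ₀ ≤ sInf (energy Λ t '' constraintSet σ ξ) := by
    refine le_of_tendsto_of_tendsto' hlow (hu.comp hφ.tendsto_atTop) fun n => ?_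
    rw [Function.comp_apply, ← hψu, (h (φ n)).energy_eq]
    gcongr with m _ α _ m _ α _
    · exact two_re_inner_sub_norm_sq_le _ _
    · exact two_re_inner_sub_norm_sq_le _ _
  exact ⟨ψ₀, hmem₀, fun χ hχ => hle.trans (csInf_le hbdd (Set.mem_image_of_mem _ hχ))⟩

end Existence

/-! ### Integration of the supergradient and the adiabatic connection. -/

section Adiabatic

/-- A function with antitone superdifferential `c` on `[0, 1]` is the integral of `c`. -/
theorem integral_eq_sub_of_supergradient {F c : ℝ → ℝ}
    (h : ∀ a ∈ Set.Icc (0 : ℝ) 1, ∀ b ∈ Set.Icc (0 : ℝ) 1, F b ≤ F a + (b - a) * c a) :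
    IntervalIntegrable c volume 0 1 ∧ ∫ s in (0 : ℝ)..1, c s = F 1 - F 0 := by
  -- Adding the inequalities for `(a, b)` and `(b, a)` gives `(b - a)(c b - c a) ≤ 0`.
  have hanti : AntitoneOn c (Set.Icc 0 1) := by
    intro a ha b hb hab
    rcases hab.eq_or_lt with rfl | hlt
    · exact le_rfl
    · have h1 := h a ha b hb
      have h2 := h b hb a ha
      nlinarith
  have hint : IntervalIntegrable c volume 0 1 := by
    refine AntitoneOn.intervalIntegrable ?_
    rwa [Set.uIcc_of_le zero_le_one]
  refine ⟨hint, ?_⟩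
  have h0 : (0 : ℝ) ∈ Set.Icc (0 : ℝ) 1 := ⟨le_rfl, zero_le_one⟩
  have h1 : (1 : ℝ) ∈ Set.Icc (0 : ℝ) 1 := ⟨zero_le_one, le_rfl⟩
  have hbound : ∀ a ∈ Set.Icc (0 : ℝ) 1, |c a| ≤ |c 0| + |c 1| := by
    intro a ha
    have h2 := hanti h0 ha ha.1
    have h3 := hanti ha h1 ha.2
    rw [abs_le]
    constructor
    · linarith [neg_abs_le (c 1), abs_nonneg (c 0)]
    · linarith [le_abs_self (c 0), abs_nonneg (c 1)]
  -- Hence `F' = c` at every interior continuity point of `c`, that is, off a countable set, since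
  -- `c` is monotone.
  have hsq : ∀ a ∈ Set.Icc (0 : ℝ) 1, ∀ b ∈ Set.Icc (0 : ℝ) 1,
      |F b - F a - (b - a) * c a| ≤ |b - a| * |c b - c a| := by
    intro a ha b hb
    have h2 := h a ha b hb
    have h3 := h b hb a ha
    rw [← abs_mul, abs_of_nonpos (by linarith)]
    refine le_trans ?_ (neg_le_abs _)
    linarith
  have hcont : ContinuousOn F (Set.uIcc 0 1) := by
    rw [Set.uIcc_of_le zero_le_one]
    refine LipschitzOnWith.continuousOn (K := (|c 0| + |c 1|).toNNReal)
      (LipschitzOnWith.of_dist_le_mul fun a ha b hb => ?_)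
    rw [Real.coe_toNNReal _ (by positivity), Real.dist_eq, Real.dist_eq]
    have h2 := h a ha b hb
    have h3 := h b hb a ha
    have h4 : |(b - a) * c a| ≤ (|c 0| + |c 1|) * |a - b| := by
      rw [abs_mul, mul_comm, abs_sub_comm b a]
      exact mul_le_mul_of_nonneg_right (hbound a ha) (abs_nonneg _)
    have h5 : |(a - b) * c b| ≤ (|c 0| + |c 1|) * |a - b| := by
      rw [abs_mul, mul_comm]
      exact mul_le_mul_of_nonneg_right (hbound b hb) (abs_nonneg _)
    rw [abs_le]
    constructor
    · linarith [le_abs_self ((b - a) * c a)]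
    · linarith [le_abs_self ((a - b) * c b)]
  refine integral_eq_of_hasDerivAt_off_countable F c (s := {a ∈ Set.Icc (0 : ℝ) 1 |
    ¬ ContinuousWithinAt c (Set.Icc 0 1) a}) hanti.countable_not_continuousWithinAt hcont
    (fun a ha => ?_) hint
  rw [min_eq_left zero_le_one, max_eq_right zero_le_one] at ha
  obtain ⟨ha, hna⟩ := ha
  have ha' := Set.Ioo_subset_Icc_self ha
  have hca : ContinuousAt c a := by
    have : ContinuousWithinAt c (Set.Icc 0 1) a := by
      by_contra hcon
      exact hna ⟨ha', hcon⟩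
    exact this.continuousAt (Icc_mem_nhds ha.1 ha.2)
  rw [hasDerivAt_iff_isLittleO, Asymptotics.isLittleO_iff]
  intro ε hε
  have h2 : ∀ᶠ b in 𝓝 a, |c b - c a| < ε := by
    have := Metric.tendsto_nhds.1 hca ε hε
    simpa only [Real.dist_eq] using this
  filter_upwards [h2, Icc_mem_nhds ha.1 ha.2] with b hb hb'
  rw [Real.norm_eq_abs, Real.norm_eq_abs, smul_eq_mul, mul_comm ε]
  exact (hsq a ha' b hb').trans (mul_le_mul_of_nonneg_left hb.le (abs_nonneg _))

variable {N M : ℕ}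

/-- The adiabatic connection at zero displacement. -/
theorem adiabatic_connection_zero (Λ : Matrix (Fin M) (Fin N) ℝ) (t σ : Fin N → ℝ)
    (hσ : ∀ n, σ n ∈ Set.Icc (-1 : ℝ) 1) {Ψ : ℝ → State N M}
    (hΨ : ∀ s ∈ Set.Icc (0 : ℝ) 1, IsOptimizer (s • Λ) t σ 0 (Ψ s)) :
    IntervalIntegrable (fun s => adiabaticIntegrand Λ t σ s (Ψ s)) volume 0 1 ∧
      energy Λ t (Ψ 1) = (M : ℝ) - ∑ n, |t n| * √(1 - σ n ^ 2)
        + (1 / 4 * ((Λ *ᵥ σ) ⬝ᵥ (Λ *ᵥ σ))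
          - ∫ s in (0 : ℝ)..1, adiabaticIntegrand Λ t σ s (Ψ s)) := by
  have h0 : (0 : ℝ) ∈ Set.Icc (0 : ℝ) 1 := ⟨le_rfl, zero_le_one⟩
  obtain ⟨hint, hval⟩ := integral_eq_sub_of_supergradient
    (F := fun s => energy (s • Λ) t (Ψ s)) (c := fun s => interaction Λ (Ψ s))
    fun a ha b hb => by
      -- The constraint set does not involve `s`, so the optimizer at `a` is a trial state at `b`.
      have h1 : energy (b • Λ) t (Ψ b) ≤ energy (b • Λ) t (Ψ a) := (hΨ b hb).2 (hΨ a ha).1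
      rw [energy_smul (hΨ a ha).1.1] at h1
      simp only [energy_smul (hΨ a ha).1.1 a]
      linarith
  have hfree : energy ((0 : ℝ) • Λ) t (Ψ 0) = (M : ℝ) - ∑ n, |t n| * √(1 - σ n ^ 2) := by
    obtain ⟨χ, hχ, hE⟩ := exists_energy_zero_eq (M := M) t σ hσ
    have h1 : energy ((0 : ℝ) • Λ) t (Ψ 0) ≤ energy ((0 : ℝ) • Λ) t χ := (hΨ 0 h0).2 hχ
    rw [zero_smul] at h1 ⊢
    exact le_antisymm (h1.trans_eq hE) (le_energy_zero (hΨ 0 h0).1 t)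
  set q := (Λ *ᵥ σ) ⬝ᵥ (Λ *ᵥ σ)
  have heq : Set.EqOn (fun s => s / 2 * q - interaction Λ (Ψ s))
      (fun s => adiabaticIntegrand Λ t σ s (Ψ s)) (Set.uIcc 0 1) := by
    intro s hs
    rw [Set.uIcc_of_le zero_le_one] at hs
    simp only [(hΨ s hs).interaction_eq]
    ring
  have hlin : IntervalIntegrable (fun s : ℝ => s / 2 * q) volume 0 1 :=
    (by fun_prop : Continuous fun s : ℝ => s / 2 * q).intervalIntegrable 0 1
  refine ⟨(hlin.sub hint).congr fun s hs => heq (Set.uIoc_subset_uIcc hs), ?_⟩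
  rw [← intervalIntegral.integral_congr heq, intervalIntegral.integral_sub hlin hint, hval, hfree,
    one_smul]
  have : ∫ s in (0 : ℝ)..1, s / 2 * q = 1 / 4 * q := by
    rw [intervalIntegral.integral_mul_const, intervalIntegral.integral_div, integral_id]
    ring
  rw [this]
  ring

end Adiabatic

end

end Dicke

/-- `IsGLB` excludes the default value `0` that `sInf` takes on empty or unbounded sets, and
`IntervalIntegrable` excludes the default value of the integral. -/
theorem theorem3p11 (N M : ℕ) (Λ : Matrix (Fin M) (Fin N) ℝ) (t : Fin N → ℝ)
    (σ : Fin N → ℝ) (hσ : ∀ n, σ n ∈ Set.Icc (-1 : ℝ) 1) :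
    (∀ ξ : Fin M → ℝ,
      IsGLB (Dicke.energy Λ t '' Dicke.constraintSet σ ξ) (Dicke.levyLieb Λ t σ ξ)) ∧
    (∀ s ∈ Set.Icc (0 : ℝ) 1, ∃ ψ : Dicke.State N M,
      Dicke.IsOptimizer (s • Λ) t σ 0 ψ ∧ Dicke.IsRealValued ψ) ∧
    ∀ Ψ : ℝ → Dicke.State N M,
      (∀ s ∈ Set.Icc (0 : ℝ) 1,
        Dicke.IsOptimizer (s • Λ) t σ 0 (Ψ s) ∧ Dicke.IsRealValued (Ψ s)) →
      IntervalIntegrable (fun s => Dicke.adiabaticIntegrand Λ t σ s (Ψ s)) volume 0 1 ∧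
      ∀ ξ : Fin M → ℝ,
        Dicke.levyLieb Λ t σ ξ
          = (M : ℝ) + ξ ⬝ᵥ ξ - ∑ n, |t n| * √(1 - σ n ^ 2) + ξ ⬝ᵥ (Λ *ᵥ σ)
            + (1 / 4 * ((Λ *ᵥ σ) ⬝ᵥ (Λ *ᵥ σ))
              - ∫ s in (0 : ℝ)..1, Dicke.adiabaticIntegrand Λ t σ s (Ψ s)) := by
  have hex : ∀ Λ' : Matrix (Fin M) (Fin N) ℝ, ∃ ψ : Dicke.State N M,
      Dicke.IsOptimizer Λ' t σ 0 ψ ∧ Dicke.IsRealValued ψ := fun Λ' => by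
    -- The noninteracting optimizer shows that the constraint set is nonempty, for every coupling.
    obtain ⟨χ, hχ, -⟩ := Dicke.exists_energy_zero_eq (M := M) t σ hσ
    obtain ⟨ψ, hψ⟩ := Dicke.exists_isOptimizer Λ' t σ 0 ⟨χ, hχ⟩
    exact hψ.exists_isRealValued
  refine ⟨fun ξ => ?_, fun s _ => hex (s • Λ), fun Ψ hΨ => ?_⟩
  · obtain ⟨ψ, hψ, -⟩ := hex Λ
    have h := hψ.displace_const ξ
    rw [h.levyLieb_eq]
    exact h.isLeast.isGLB
  · obtain ⟨hint, hE⟩ :=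
      Dicke.adiabatic_connection_zero Λ t σ hσ (Ψ := Ψ) fun s hs => (hΨ s hs).1
    refine ⟨hint, fun ξ => ?_⟩
    have h1 := (hΨ 1 ⟨zero_le_one, le_rfl⟩).1
    rw [one_smul] at h1
    rw [h1.levyLieb_displaced ξ, hE]
    ring
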